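/- Let $G$ be an abelian group. For a locally compact Hausdorff space $X$, call $E\subseteq X$ bounded if $\overline{E}$ is compact. For $n\ge 0$ let $K_n(X,G)$ be the group, under pointwise addition, of the functions $f$ that assign to each $(n+1)$-tuple $(E_0,\dots,E_n)$ of bounded subsets of $X$ an element of $G$, such that 1. if $E_i=E_i'\cup E_i''$ and $E_i'\cap E_i''=\varnothing$, then $f(\dots,E_i,\dots)=f(\dots,E_i',\dots)+f(\dots,E_i'',\dots)$; 2. $f(E_{\sigma(0)},\dots,E_{\sigma(n)})=\operatorname{sgn}(\sigma)\,f(E_0,\dots,E_n)$ for every permutation $\sigma$, and $f(E_0,\dots,E_n)=0$ if $E_i=E_j$ for some $i\ne j$; 3. $f(E_0,\dots,E_n)=0$ if $\overline{E_0}\cap\dots\cap\overline{E_n}=\varnothing$. For $n\ge 1$ the boundary $\Delta:K_n(X,G)\to K_{n-1}(X,G)$ is $\Delta f(E_0,\dots,E_{n-1})=f(U,E_0,\dots,E_{n-1})$, where $U$ is any bounded open set containing $\bigcup_{i=0}^{n-1}\overline{E_i}$ (the value does not depend on $U$), and $\Delta=0$ on $K_0(X,G)$. The Kolmogoroff homology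 $H^K_*(X;G)$ is the homology of $(K_*(X,G),\Delta)$. For a closed subspace $A\subseteq X$, with inclusion $i:A\to X$, let $i_*:K_*(A,G)\to K_*(X,G)$ be the chain map $(i_*f)(E_0,\dots,E_n)=f(E_0\cap A,\dots,E_n\cap A)$; the relative homology $H^K_*(X,A;G)$ is the homology of the quotient complex $K_*(X,G)/i_*K_*(A,G)$. **Corollary 2.** Let $X$ be a locally compact, paracompact Hausdorff space, let $\dot X=X\cup\{*\}$ be its one-point Alexandroff compactification, and let $G$ be an abelian group. Then the inclusion $\rho:X\to(\dot X,*)$ induces for every $n\ge 0$ an isomorphism $$\rho_*: H^K_n(X;G)\overset{\sim}{\longrightarrow} H^K_n(\dot X,*;G).$$ Here $\rho_*$ is the inverse of the homomorphism $H^K_n(\dot X,*;G)\to H^K_n(X;G)$ that is induced by the restriction of chains along the open inclusion $\rho$: a chain $f\in K_n(\dot X,G)$ is sent to the chain $(E_0,\dots,E_n)\mapsto f(E_0,\dots,E_n)$ on bounded subsets $E_i$ of $X$, and chains coming from $*$ are sent to $0$. In particular, this restriction homomorphism is an isomorphism. -/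

import Mathlib

open CategoryTheory CategoryTheory.Limits Topology

universe u v

namespace Kolmogoroff

section Chains

variable {X Y : Type u} [TopologicalSpace X] [TopologicalSpace Y] {G : Type v} [AddCommGroup G]

/-- The bounded subsets of `X`: those with compact closure. -/
abbrev Bdd (X : Type u) [TopologicalSpace X] : Type u := {E : Set X // IsCompact (closure E)}

/-- The defining conditions of an `n`-dimensional Kolmogoroff chain. -/
structure IsChain {n : ℕ} (f : (Fin (n + 1) → Bdd X) → G) : Prop where
  /-- additivity in each argument -/
  add : ∀ (E : Fin (n + 1) → Bdd X) (i : Fin (n + 1)) (A B : Bdd X),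
    (E i).1 = A.1 ∪ B.1 → A.1 ∩ B.1 = ∅ →
      f E = f (Function.update E i A) + f (Function.update E i B)
  /-- skew-symmetry -/
  perm : ∀ (E : Fin (n + 1) → Bdd X) (σ : Equiv.Perm (Fin (n + 1))),
    f (fun i => E (σ i)) = (Equiv.Perm.sign σ : ℤ) • f E
  /-- vanishing when two arguments coincide -/
  alt : ∀ (E : Fin (n + 1) → Bdd X) (i j : Fin (n + 1)), i ≠ j → E i = E j → f E = 0
  /-- vanishing when the closures have no common point -/
  supp : ∀ E : Fin (n + 1) → Bdd X, ⋂ i, closure (E i).1 = ∅ → f E = 0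

/-- The group `K_n(X, G)` of `n`-dimensional Kolmogoroff chains, under pointwise addition. -/
def chains (X : Type u) [TopologicalSpace X] (G : Type v) [AddCommGroup G] (n : ℕ) :
    AddSubgroup ((Fin (n + 1) → Bdd X) → G) where
  carrier := {f | IsChain f}
  zero_mem' := by constructor <;> simp
  add_mem' := by
    intro f g hf hg
    refine ⟨fun E i A B h h' => ?_, fun E σ => ?_, fun E i j h h' => ?_, fun E h => ?_⟩
    · simp only [Pi.add_apply, hf.add E i A B h h', hg.add E i A B h h']; abel
    · simp only [Pi.add_apply, hf.perm E σ, hg.perm E σ, smul_add]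
    · simp only [Pi.add_apply, hf.alt E i j h h', hg.alt E i j h h', add_zero]
    · simp only [Pi.add_apply, hf.supp E h, hg.supp E h, add_zero]
  neg_mem' := by
    intro f hf
    refine ⟨fun E i A B h h' => ?_, fun E σ => ?_, fun E i j h h' => ?_, fun E h => ?_⟩
    · simp only [Pi.neg_apply, hf.add E i A B h h']; abel
    · simp only [Pi.neg_apply, hf.perm E σ, smul_neg]
    · simp only [Pi.neg_apply, hf.alt E i j h h', neg_zero]
    · simp only [Pi.neg_apply, hf.supp E h, neg_zero]

/-- `U` may be used to compute the boundary at `E`: it is open and contains all `closure (E i)`. -/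
def Surrounds {n : ℕ} (U : Bdd X) (E : Fin (n + 1) → Bdd X) : Prop :=
  IsOpen U.1 ∧ ⋃ i, closure (E i).1 ⊆ U.1

theorem Surrounds.closure_subset {n : ℕ} {U : Bdd X} {E : Fin (n + 1) → Bdd X}
    (h : Surrounds U E) (i : Fin (n + 1)) : closure (E i).1 ⊆ U.1 :=
  (Set.subset_iUnion (fun i => closure (E i).1) i).trans h.2

theorem exists_surrounds [LocallyCompactSpace X] [T2Space X] {n : ℕ} (E : Fin (n + 1) → Bdd X) :
    ∃ U : Bdd X, Surrounds U E := by
  obtain ⟨U, hU, hEU, hc⟩ := exists_isOpen_superset_and_isCompact_closure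
    (isCompact_iUnion fun i => (E i).2)
  exact ⟨⟨U, hc⟩, hU, hEU⟩

/-- A bounded open set surrounding `E`. -/
noncomputable def surround [LocallyCompactSpace X] [T2Space X] {n : ℕ}
    (E : Fin (n + 1) → Bdd X) : Bdd X :=
  (exists_surrounds E).choose

theorem surround_spec [LocallyCompactSpace X] [T2Space X] {n : ℕ} (E : Fin (n + 1) → Bdd X) :
    Surrounds (surround E) E :=
  (exists_surrounds E).choose_spec

/-- Replacing the first argument by a subset that is still a neighbourhood of the closure of some
other argument does not change the value. -/
theorem IsChain.cons_eq_of_subset {n : ℕ} {f : (Fin (n + 1 + 1) → Bdd X) → G} (hf : IsChain f)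
    (E : Fin (n + 1) → Bdd X) (i : Fin (n + 1)) (U V : Bdd X) (hV : IsOpen V.1)
    (hVU : V.1 ⊆ U.1) (hi : closure (E i).1 ⊆ V.1) :
    f (Fin.cons U E) = f (Fin.cons V E) := by
  have hW : IsCompact (closure (U.1 \ V.1)) :=
    U.2.of_isClosed_subset isClosed_closure (closure_mono Set.sdiff_subset)
  have h := hf.add (Fin.cons U E) 0 V ⟨U.1 \ V.1, hW⟩
    (Set.union_sdiff_cancel hVU).symm (Set.inter_sdiff_self _ _)
  rw [Fin.update_cons_zero, Fin.update_cons_zero] at h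
  rw [h, hf.supp (Fin.cons ⟨U.1 \ V.1, hW⟩ E), add_zero]
  rw [Set.eq_empty_iff_forall_notMem]
  intro x hx
  rw [Set.mem_iInter] at hx
  have h0 : x ∈ closure (U.1 \ V.1) := by simpa using hx 0
  have h1 : x ∈ closure (E i).1 := by simpa using hx i.succ
  have h2 : closure (U.1 \ V.1) ⊆ V.1ᶜ :=
    closure_minimal (fun y hy => hy.2) hV.isClosed_compl
  exact h2 h0 (hi h1)

theorem IsChain.cons_eq {n : ℕ} {f : (Fin (n + 1 + 1) → Bdd X) → G} (hf : IsChain f)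
    (E : Fin (n + 1) → Bdd X) (i : Fin (n + 1)) (U V : Bdd X) (hU : IsOpen U.1) (hV : IsOpen V.1)
    (hiU : closure (E i).1 ⊆ U.1) (hiV : closure (E i).1 ⊆ V.1) :
    f (Fin.cons U E) = f (Fin.cons V E) := by
  have hW : IsCompact (closure (U.1 ∩ V.1)) :=
    U.2.of_isClosed_subset isClosed_closure (closure_mono Set.inter_subset_left)
  rw [hf.cons_eq_of_subset E i U ⟨U.1 ∩ V.1, hW⟩ (hU.inter hV) Set.inter_subset_left
      (Set.subset_inter hiU hiV),
    hf.cons_eq_of_subset E i V ⟨U.1 ∩ V.1, hW⟩ (hU.inter hV) Set.inter_subset_right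
      (Set.subset_inter hiU hiV)]

section Boundary

variable [LocallyCompactSpace X] [T2Space X]

/-- The boundary `Δ f (E₀, …, E_{n-1}) = f (U, E₀, …, E_{n-1})`, as a function. -/
noncomputable def bdryFun {n : ℕ} (f : (Fin (n + 1 + 1) → Bdd X) → G)
    (E : Fin (n + 1) → Bdd X) : G :=
  f (Fin.cons (surround E) E)

/-- The boundary does not depend on the choice of the surrounding set. -/
theorem bdryFun_eq {n : ℕ} {f : (Fin (n + 1 + 1) → Bdd X) → G} (hf : IsChain f)
    (E : Fin (n + 1) → Bdd X) (U : Bdd X) (hU : Surrounds U E) :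
    bdryFun f E = f (Fin.cons U E) :=
  hf.cons_eq E 0 _ U (surround_spec E).1 hU.1 ((surround_spec E).closure_subset 0)
    (hU.closure_subset 0)

theorem IsChain.bdryFun {n : ℕ} {f : (Fin (n + 1 + 1) → Bdd X) → G} (hf : IsChain f) :
    IsChain (bdryFun f) := by
  refine ⟨fun E i A B h h' => ?_, fun E σ => ?_, fun E i j h h' => ?_, fun E h => ?_⟩
  · have key : ∀ C : Bdd X, C.1 ⊆ (E i).1 → Surrounds (surround E) (Function.update E i C) := by
      intro C hC
      refine ⟨(surround_spec E).1, Set.iUnion_subset fun j => ?_⟩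
      by_cases hj : j = i
      · subst hj
        rw [Function.update_self]
        exact (closure_mono hC).trans ((surround_spec E).closure_subset j)
      · rw [Function.update_of_ne hj]
        exact (surround_spec E).closure_subset j
    rw [bdryFun_eq hf _ _ (surround_spec E),
      bdryFun_eq hf _ _ (key A (h ▸ Set.subset_union_left)),
      bdryFun_eq hf _ _ (key B (h ▸ Set.subset_union_right)), Fin.cons_update, Fin.cons_update]
    exact hf.add _ i.succ A B (by simpa using h) h'
  · have hs : Surrounds (surround E) (fun i => E (σ i)) :=
      ⟨(surround_spec E).1, Set.iUnion_subset fun j => (surround_spec E).closure_subset (σ j)⟩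
    rw [bdryFun_eq hf _ _ hs, bdryFun_eq hf _ _ (surround_spec E)]
    have h := hf.perm (Fin.cons (surround E) E) (Equiv.Perm.decomposeFin.symm (0, σ))
    rw [Equiv.Perm.decomposeFin.symm_sign, if_pos rfl, one_mul] at h
    rw [← h]
    congr 1
    funext j
    refine Fin.cases ?_ (fun k => ?_) j
    · simp
    · simp
  · exact hf.alt _ i.succ j.succ (by simpa using h) (by simpa using h')
  · refine hf.supp _ ?_
    rw [Set.eq_empty_iff_forall_notMem] at h ⊢
    intro x hx
    rw [Set.mem_iInter] at hx
    exact h x (Set.mem_iInter.2 fun i => by simpa using hx i.succ)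

theorem IsChain.bdryFun_bdryFun {n : ℕ} {f : (Fin (n + 1 + 1 + 1) → Bdd X) → G}
    (hf : IsChain f) (E : Fin (n + 1) → Bdd X) :
    Kolmogoroff.bdryFun (Kolmogoroff.bdryFun f) E = 0 := by
  set U := surround E with hU
  set W := surround (Fin.cons U E : Fin (n + 1 + 1) → Bdd X) with hW
  have hWs := surround_spec (Fin.cons U E : Fin (n + 1 + 1) → Bdd X)
  change f (Fin.cons W (Fin.cons U E)) = 0
  have h1 := hf.perm (Fin.cons W (Fin.cons U E)) (Equiv.swap 0 1)
  have h2 : (fun i => (Fin.cons W (Fin.cons U E) : Fin (n + 1 + 1 + 1) → Bdd X)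
      (Equiv.swap 0 1 i)) = Fin.cons U (Fin.cons W E) := by
    funext j
    refine Fin.cases ?_ (fun k => Fin.cases ?_ (fun l => ?_) k) j
    · rw [Equiv.swap_apply_left]; rfl
    · rw [Fin.succ_zero_eq_one, Equiv.swap_apply_right]; rfl
    · rw [Equiv.swap_apply_of_ne_of_ne (Fin.succ_ne_zero _)
        (by
          rw [← Fin.succ_zero_eq_one]
          exact fun h => Fin.succ_ne_zero l (Fin.succ_injective _ h))]
      rfl
  have h3 : f (Fin.cons U (Fin.cons W E)) = f (Fin.cons W (Fin.cons W E)) := by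
    refine hf.cons_eq (Fin.cons W E) (Fin.succ 0) U W (surround_spec E).1 hWs.1 ?_ ?_
    · exact (surround_spec E).closure_subset 0
    · exact hWs.closure_subset (Fin.succ 0)
  rw [h2, h3, hf.alt (Fin.cons W (Fin.cons W E)) 0 (Fin.succ 0) (Fin.succ_ne_zero 0).symm rfl,
    Equiv.Perm.sign_swap (by simp)] at h1
  simpa using h1

/-- The boundary operator `Δ : K_{n+1}(X, G) → K_n(X, G)`. -/
noncomputable def bdry (X : Type u) [TopologicalSpace X] [LocallyCompactSpace X] [T2Space X]
    (G : Type v) [AddCommGroup G] (n : ℕ) : chains X G (n + 1) →+ chains X G n where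
  toFun f := ⟨bdryFun f.1, IsChain.bdryFun f.2⟩
  map_zero' := rfl
  map_add' _ _ := rfl

end Boundary

/-- Precomposition with an operation on bounded sets that preserves disjoint unions and families
of sets whose closures have no common point. -/
theorem IsChain.comp {n : ℕ} {f : (Fin (n + 1) → Bdd X) → G} (hf : IsChain f)
    (φ : Bdd Y → Bdd X)
    (hu : ∀ A B C : Bdd Y, C.1 = A.1 ∪ B.1 → (φ C).1 = (φ A).1 ∪ (φ B).1)
    (hd : ∀ A B : Bdd Y, A.1 ∩ B.1 = ∅ → (φ A).1 ∩ (φ B).1 = ∅)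
    (hs : ∀ E : Fin (n + 1) → Bdd Y, ⋂ i, closure (E i).1 = ∅ → ⋂ i, closure (φ (E i)).1 = ∅) :
    IsChain (fun E : Fin (n + 1) → Bdd Y => f (fun i => φ (E i))) := by
  have key : ∀ (E : Fin (n + 1) → Bdd Y) (i : Fin (n + 1)) (A : Bdd Y),
      (fun j => φ (Function.update E i A j)) = Function.update (fun j => φ (E j)) i (φ A) := by
    intro E i A
    funext j
    by_cases hj : j = i
    · subst hj; simp
    · simp [hj]
  refine ⟨fun E i A B h h' => ?_, fun E σ => ?_, fun E i j h h' => ?_, fun E h => ?_⟩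
  · simp only [key]
    exact hf.add _ i _ _ (hu A B (E i) h) (hd A B h')
  · exact hf.perm (fun i => φ (E i)) σ
  · exact hf.alt _ i j h (congrArg φ h')
  · exact hf.supp _ (hs E h)

/-- The preimage of a bounded set under a proper map. -/
def Bdd.preimage (p : X → Y) (hp : IsProperMap p) (E : Bdd Y) : Bdd X :=
  ⟨p ⁻¹' E.1, (hp.isCompact_preimage E.2).of_isClosed_subset isClosed_closure
    (hp.continuous.closure_preimage_subset E.1)⟩

/-- The image of a bounded set under a continuous map to a Hausdorff space. -/
def Bdd.image [T2Space Y] (j : X → Y) (hj : Continuous j) (E : Bdd X) : Bdd Y :=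
  ⟨j '' E.1, (E.2.image hj).of_isClosed_subset isClosed_closure
    (closure_minimal (Set.image_mono subset_closure) (E.2.image hj).isClosed)⟩

theorem Bdd.closure_image [T2Space Y] (j : X → Y) (hj : Continuous j) (E : Bdd X) :
    closure (Bdd.image j hj E).1 = j '' closure E.1 :=
  (closure_minimal (Set.image_mono subset_closure) (E.2.image hj).isClosed).antisymm
    (image_closure_subset_closure_image hj)

/-- A proper map `p : X → Y` induces `p_* : K_n(X, G) → K_n(Y, G)`,
`(p_* f)(E₀, …, E_n) = f (p⁻¹ E₀, …, p⁻¹ E_n)`. -/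
def push (G : Type v) [AddCommGroup G] (p : X → Y) (hp : IsProperMap p) (n : ℕ) :
    chains X G n →+ chains Y G n where
  toFun f := ⟨fun E => f.1 (fun i => Bdd.preimage p hp (E i)), by
    refine IsChain.comp f.2 (Bdd.preimage p hp) (fun A B C h => ?_) (fun A B h => ?_)
      (fun E h => ?_)
    · simp only [Bdd.preimage, h, Set.preimage_union]
    · simp only [Bdd.preimage, ← Set.preimage_inter, h, Set.preimage_empty]
    · rw [Set.eq_empty_iff_forall_notMem] at h ⊢
      intro x hx
      rw [Set.mem_iInter] at hx
      exact h (p x) (Set.mem_iInter.2 fun i =>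
        hp.continuous.closure_preimage_subset (E i).1 (hx i))⟩
  map_zero' := rfl
  map_add' _ _ := rfl

/-- An open embedding `j : X → Y` induces the restriction `K_n(Y, G) → K_n(X, G)`,
`f ↦ ((E₀, …, E_n) ↦ f (j E₀, …, j E_n))`. -/
def restrict [T2Space Y] (G : Type v) [AddCommGroup G] (j : X → Y) (hj : IsOpenEmbedding j)
    (n : ℕ) : chains Y G n →+ chains X G n where
  toFun f := ⟨fun E => f.1 (fun i => Bdd.image j hj.continuous (E i)), by
    refine IsChain.comp f.2 (Bdd.image j hj.continuous) (fun A B C h => ?_) (fun A B h => ?_)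
      (fun E h => ?_)
    · simp only [Bdd.image, h, Set.image_union]
    · simp only [Bdd.image, ← Set.image_inter hj.injective, h, Set.image_empty]
    · simp only [Bdd.closure_image]
      rw [← Set.InjOn.image_iInter_eq hj.injective.injOn, h, Set.image_empty]⟩
  map_zero' := rfl
  map_add' _ _ := rfl

theorem push_bdry [LocallyCompactSpace X] [T2Space X] [LocallyCompactSpace Y] [T2Space Y]
    (p : X → Y) (hp : IsProperMap p) (n : ℕ) (f : chains X G (n + 1)) :
    bdry Y G n (push G p hp (n + 1) f) = push G p hp n (bdry X G n f) := by
  refine Subtype.ext (funext fun E => ?_)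
  have hs : Surrounds (Bdd.preimage p hp (surround E)) (fun i => Bdd.preimage p hp (E i)) :=
    ⟨(surround_spec E).1.preimage hp.continuous, Set.iUnion_subset fun i =>
      (hp.continuous.closure_preimage_subset (E i).1).trans
        (Set.preimage_mono ((surround_spec E).closure_subset i))⟩
  refine Eq.trans ?_ (bdryFun_eq f.2 _ _ hs).symm
  change f.1 _ = f.1 _
  refine congrArg f.1 (funext fun i => ?_)
  refine Fin.cases ?_ (fun k => ?_) i <;> rfl

theorem restrict_bdry [LocallyCompactSpace X] [T2Space X] [LocallyCompactSpace Y] [T2Space Y]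
    (j : X → Y) (hj : IsOpenEmbedding j) (n : ℕ) (f : chains Y G (n + 1)) :
    bdry X G n (restrict G j hj (n + 1) f) = restrict G j hj n (bdry Y G n f) := by
  refine Subtype.ext (funext fun E => ?_)
  have hs : Surrounds (Bdd.image j hj.continuous (surround E))
      (fun i => Bdd.image j hj.continuous (E i)) :=
    ⟨hj.isOpenMap _ (surround_spec E).1, Set.iUnion_subset fun i => by
      rw [Bdd.closure_image]
      exact Set.image_mono ((surround_spec E).closure_subset i)⟩
  refine Eq.trans ?_ (bdryFun_eq f.2 _ _ hs).symm
  change f.1 _ = f.1 _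
  refine congrArg f.1 (funext fun i => ?_)
  refine Fin.cases ?_ (fun k => ?_) i <;> rfl

/-- Restricting to an open set that misses the image of `p` annihilates `p_*`. -/
theorem restrict_push {A : Type u} [TopologicalSpace A] [T2Space Y] (p : A → Y)
    (hp : IsProperMap p) (j : X → Y) (hj : IsOpenEmbedding j) (h : ∀ a x, p a ≠ j x) (n : ℕ)
    (f : chains A G n) : restrict G j hj n (push G p hp n f) = 0 := by
  refine Subtype.ext (funext fun E => ?_)
  refine IsChain.supp f.2 _ ?_
  have he : ∀ i, (Bdd.preimage p hp (Bdd.image j hj.continuous (E i))).1 = ∅ := by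
    intro i
    rw [Set.eq_empty_iff_forall_notMem]
    rintro a ⟨x, -, hx⟩
    exact h a x hx.symm
  simp only [he, closure_empty]
  exact Set.iInter_const _

end Chains

section Complex

variable (X : Type u) [TopologicalSpace X] [LocallyCompactSpace X] [T2Space X]
  {Y : Type u} [TopologicalSpace Y] [LocallyCompactSpace Y] [T2Space Y]
  (G : Type v) [AddCommGroup G]

/-- The Kolmogoroff chain complex `K_*(X, G)`. -/
noncomputable def complex : ChainComplex AddCommGrpCat.{max u v} ℕ :=
  ChainComplex.of (fun n => AddCommGrpCat.of (chains X G n))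
    (fun n => AddCommGrpCat.ofHom (bdry X G n)) (fun n => by
      refine AddCommGrpCat.hom_ext (AddMonoidHom.ext fun f => ?_)
      exact Subtype.ext (funext fun E => IsChain.bdryFun_bdryFun f.2 E))

/-- Kolmogoroff homology of a locally compact Hausdorff space. -/
noncomputable def homology (n : ℕ) : AddCommGrpCat.{max u v} :=
  (complex X G).homology n

variable {X}

/-- The chain map `K_*(X, G) → K_*(Y, G)` induced by a proper map. -/
noncomputable def pushMap (p : X → Y) (hp : IsProperMap p) : complex X G ⟶ complex Y G :=
  ChainComplex.ofHom (fun n => AddCommGrpCat.ofHom (push G p hp n)) (fun n => by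
    simp only [complex, ChainComplex.of_d]
    refine AddCommGrpCat.hom_ext (AddMonoidHom.ext fun f => ?_)
    exact push_bdry p hp n f)

/-- The chain map `K_*(Y, G) → K_*(X, G)` induced by an open embedding `X → Y`. -/
noncomputable def restrictMap (j : X → Y) (hj : IsOpenEmbedding j) :
    complex Y G ⟶ complex X G :=
  ChainComplex.ofHom (fun n => AddCommGrpCat.ofHom (restrict G j hj n)) (fun n => by
    simp only [complex, ChainComplex.of_d]
    refine AddCommGrpCat.hom_ext (AddMonoidHom.ext fun f => ?_)
    exact restrict_bdry j hj n f)

theorem isProperMap_val {Z : Type u} [TopologicalSpace Z] {A : Set Z} (hA : IsClosed A) :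
    IsProperMap ((↑) : A → Z) :=
  hA.isClosedEmbedding_subtypeVal.isProperMap

/-- The relative chain complex `K_*(Y, A; G) = K_*(Y, G) / K_*(A, G)` of a closed subspace `A`:
the cokernel of the chain map induced by the inclusion `A → Y`. -/
noncomputable def relComplex (A : Set Y) (hA : IsClosed A) :
    ChainComplex AddCommGrpCat.{max u v} ℕ :=
  haveI : LocallyCompactSpace A := hA.isClosedEmbedding_subtypeVal.locallyCompactSpace
  cokernel (pushMap G ((↑) : A → Y) (isProperMap_val hA))

/-- Relative Kolmogoroff homology of a closed pair. -/
noncomputable def relHomology (A : Set Y) (hA : IsClosed A) (n : ℕ) :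
    AddCommGrpCat.{max u v} :=
  (relComplex G A hA).homology n

/-- The chain map `K_*(Y, A; G) → K_*(X, G)` induced by an open embedding `j : X → Y` whose image
misses the closed set `A`. -/
noncomputable def relRestrictMap (A : Set Y) (hA : IsClosed A) (j : X → Y)
    (hj : IsOpenEmbedding j) (h : ∀ x, j x ∉ A) : relComplex G A hA ⟶ complex X G :=
  haveI : LocallyCompactSpace A := hA.isClosedEmbedding_subtypeVal.locallyCompactSpace
  cokernel.desc (pushMap G ((↑) : A → Y) (isProperMap_val hA)) (restrictMap G j hj) (by
    refine HomologicalComplex.hom_ext _ _ fun n => ?_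
    refine AddCommGrpCat.hom_ext (AddMonoidHom.ext fun f => ?_)
    exact restrict_push _ (isProperMap_val hA) j hj (fun a x e => h x (e ▸ a.2)) n f)

/-- The map `H_n(Y, A; G) → H_n(X; G)` induced on homology by an open embedding `j : X → Y` whose
image misses `A`. Kolmogoroff chains are covariant for proper maps and contravariant for open
embeddings; `X → (Y, A)` acts on homology through this map. -/
noncomputable def relRestrict (A : Set Y) (hA : IsClosed A) (j : X → Y)
    (hj : IsOpenEmbedding j) (h : ∀ x, j x ∉ A) (n : ℕ) :
    relHomology G A hA n ⟶ homology X G n :=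
  HomologicalComplex.homologyMap (relRestrictMap G A hA j hj h) n

end Complex

end Kolmogoroff

/-! The restriction from `OnePoint X` to `X` is surjective on chains, and modulo the chains of the
point its kernel is acyclic. The long exact homology sequence then gives the isomorphism.

Acyclicity: a chain `F` on `OnePoint X` with zero restriction vanishes as soon as the closure of one
argument misses infinity (`eq_zero_of_restrict_eq_zero`). This makes the cone of `F` with vertex
infinity, the alternating product of the Dirac mass there with `F`, a chain again. Its boundary is
`F` minus the cone of the boundary of `F`; in degree zero the second term is replaced by a mass at
infinity, which is zero in the quotient (`bdry_inftyCone`, `bdry_inftyCone_add_push`).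

Surjectivity (`restrict_surjective`): a chain is treated as a homomorphism on a group of functions.
A box `E₀ × … × E_n` is represented by its alternating indicator on tuples of ultrafilters with a
common limit. Every linear relation among these indicators holds for the values of every chain
(`IsChain.sum_smul_eq_zero`), so a chain `f` on `X` is a homomorphism `φ` on the span of the boxes
from `X`. To extend it, the part of a box concentrated at infinity is split off. That part is the
wedge of the germs of the `E_i` at infinity, in an exterior power of the integer-valued locally
constant functions on a profinite space. Nöbeling's theorem makes these functions, hence their
exterior power, free, so the wedges lift linearly to combinations of boxes. A box minus the lift of
its wedge has the indicator of a combination of boxes from `X` (`linearCombination_boxInd_mem`), and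
`φ` applies to it. -/

namespace Kolmogoroff

/-! ### Alternating sums over tuples -/

section Combinatorics

/-- A sum against an alternating function of tuples, collected over the increasing tuples. -/
theorem sum_smul_eq_sum_strictMono {N : ℕ} {ι : Type*} [Fintype ι] [LinearOrder ι] {H : Type*}
    [AddCommGroup H] (c : (Fin N → ι) → ℤ) (b : (Fin N → ι) → H)
    (hperm : ∀ (j : Fin N → ι) (σ : Equiv.Perm (Fin N)),
      b (fun i => j (σ i)) = (Equiv.Perm.sign σ : ℤ) • b j)
    (hinj : ∀ j : Fin N → ι, ¬ Function.Injective j → b j = 0) :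
    ∑ j, c j • b j = ∑ s : {s : Fin N → ι // StrictMono s},
      (∑ σ : Equiv.Perm (Fin N), (Equiv.Perm.sign σ : ℤ) * c (fun i => s.1 (σ i))) • b s.1 := by
  have h1 : ∀ s : {s : Fin N → ι // StrictMono s},
      (∑ σ : Equiv.Perm (Fin N), (Equiv.Perm.sign σ : ℤ) * c (fun i => s.1 (σ i))) • b s.1 =
      ∑ σ : Equiv.Perm (Fin N), c (fun i => s.1 (σ i)) • b (fun i => s.1 (σ i)) := by
    intro s
    rw [Finset.sum_smul]
    refine Finset.sum_congr rfl fun σ _ => ?_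
    rw [hperm, smul_smul, mul_comm]
  rw [Finset.sum_congr rfl fun s _ => h1 s, ← Fintype.sum_prod_type'
    (f := fun (s : {s : Fin N → ι // StrictMono s}) (σ : Equiv.Perm (Fin N)) =>
      c (fun i => s.1 (σ i)) • b (fun i => s.1 (σ i)))]
  symm
  -- An injective tuple is an increasing one precomposed with a unique permutation, found by
  -- sorting; the remaining tuples contribute zero.
  refine Finset.sum_of_injOn (fun x i => x.1.1 (x.2 i)) ?_ (by simp) ?_ (fun _ _ => rfl)
  · rintro ⟨⟨s, hs⟩, σ⟩ - ⟨⟨t, ht⟩, τ⟩ - h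
    have hr : Set.range s = Set.range t := by
      have h2 := congrArg Set.range h
      have h3 : ∀ (r : Fin N → ι) (ρ : Equiv.Perm (Fin N)),
          Set.range (fun i => r (ρ i)) = Set.range r := fun r ρ => ρ.surjective.range_comp r
      simpa only [h3] using h2
    have hst : s = t := (StrictMono.range_inj hs ht).1 hr
    subst hst
    have : σ = τ := by
      ext i
      exact congrArg Fin.val (hs.injective (congrFun h i))
    rw [this]
  · intro j _ hj
    rw [hinj j, smul_zero]
    intro hi
    refine hj ⟨⟨⟨j ∘ Tuple.sort j, ?_⟩, (Tuple.sort j)⁻¹⟩, by simp, ?_⟩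
    · exact (Tuple.monotone_sort j).strictMono_of_injective
        (hi.comp (Tuple.sort j).injective)
    · funext i
      simp

/-- The matrix of coincidences of two increasing tuples has determinant one if they are equal and
zero otherwise. -/
theorem det_strictMono {N : ℕ} {ι : Type*} [LinearOrder ι] {s t : Fin N → ι}
    (hs : StrictMono s) (ht : StrictMono t) :
    (Matrix.of fun i l => if s i = t l then (1 : ℤ) else 0).det = if s = t then 1 else 0 := by
  split_ifs with h
  · subst h
    convert Matrix.det_one (n := Fin N) (R := ℤ)
    ext i l
    simp [Matrix.one_apply, hs.injective.eq_iff]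
  -- Increasing tuples are determined by their ranges, so distinct ones of equal length leave some
  -- `s i` outside the range of `t`; the row of that `i` is zero.
  · have : ∃ i, s i ∉ Set.range t := by
      by_contra! hc
      have hsub : Finset.univ.image s ⊆ Finset.univ.image t := by
        intro x hx
        obtain ⟨i, -, rfl⟩ := Finset.mem_image.1 hx
        obtain ⟨l, hl⟩ := hc i
        exact Finset.mem_image.2 ⟨l, Finset.mem_univ _, hl⟩
      have heq := Finset.eq_of_subset_of_card_le hsub (by
        rw [Finset.card_image_of_injective _ hs.injective,
          Finset.card_image_of_injective _ ht.injective])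
      refine h ((StrictMono.range_inj hs ht).1 ?_)
      have := congrArg (fun F : Finset ι => (F : Set ι)) heq
      simpa using this
    obtain ⟨i, hi⟩ := this
    refine Matrix.det_eq_zero_of_row_eq_zero i fun l => ?_
    simp only [Matrix.of_apply, ite_eq_right_iff, one_ne_zero, imp_false]
    exact fun e => hi ⟨l, e.symm⟩

end Combinatorics

/-! ### Additive functions and finite partitions -/

section Additive

variable {Y : Type u} [TopologicalSpace Y] {H : Type*} [AddCommGroup H]

theorem Bdd.isCompact_closure_of_subset {A : Bdd Y} {s : Set Y} (h : s ⊆ A.1) :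
    IsCompact (closure s) :=
  A.2.of_isClosed_subset isClosed_closure (closure_mono h)

/-- Additivity in each argument of a function of tuples of bounded sets. -/
def IsAdditive {N : ℕ} (b : (Fin N → Bdd Y) → H) : Prop :=
  ∀ (E : Fin N → Bdd Y) (i : Fin N) (A B : Bdd Y),
    (E i).1 = A.1 ∪ B.1 → A.1 ∩ B.1 = ∅ →
      b E = b (Function.update E i A) + b (Function.update E i B)

theorem IsAdditive.eq_zero_of_eq_empty {N : ℕ} {b : (Fin N → Bdd Y) → H} (hb : IsAdditive b)
    {E : Fin N → Bdd Y} {i : Fin N} (h : (E i).1 = ∅) : b E = 0 := by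
  -- The empty set is the disjoint union of two copies of itself, so `b E = b E + b E`.
  have := hb E i (E i) (E i) (Set.union_self _).symm (by rw [h, Set.inter_self])
  rwa [Function.update_eq_self, left_eq_add] at this

theorem IsAdditive.eq_sum_update {N : ℕ} {ι : Type*} {b : (Fin N → Bdd Y) → H}
    (hb : IsAdditive b) (p : ι → Bdd Y) (hp : ∀ j k, j ≠ k → (p j).1 ∩ (p k).1 = ∅) (i : Fin N)
    (S : Finset ι) (E : Fin N → Bdd Y) (hE : (E i).1 = ⋃ j ∈ S, (p j).1) :
    b E = ∑ j ∈ S, b (Function.update E i (p j)) := by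
  classical
  induction S using Finset.induction_on generalizing E with
  | empty => simpa using hb.eq_zero_of_eq_empty (by simpa using hE)
  | insert a S ha ih =>
    have hc : IsCompact (closure (⋃ j ∈ S, (p j).1)) :=
      Bdd.isCompact_closure_of_subset (A := E i) (by
        rw [hE]; exact Set.biUnion_subset_biUnion_left (by simp))
    have hd : (p a).1 ∩ ⋃ j ∈ S, (p j).1 = ∅ := by
      rw [Set.inter_iUnion₂]
      simp only [Set.iUnion_eq_empty]
      exact fun j hj => hp a j fun e => ha (e ▸ hj)
    rw [Finset.sum_insert ha, hb E i (p a) ⟨_, hc⟩ (by rw [hE]; simp) hd,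
      ih (Function.update E i ⟨_, hc⟩) (by simp)]
    simp

theorem IsAdditive.eq_sum_piFinset {N : ℕ} {ι : Type*} {b : (Fin N → Bdd Y) → H}
    (hb : IsAdditive b) (p : ι → Bdd Y) (hp : ∀ j k, j ≠ k → (p j).1 ∩ (p k).1 = ∅)
    (S : Fin N → Finset ι) (E : Fin N → Bdd Y) (hE : ∀ i, (E i).1 = ⋃ j ∈ S i, (p j).1) :
    b E = ∑ j ∈ Fintype.piFinset S, b (fun i => p (j i)) := by
  classical
  induction N with
  | zero => simpa using congrArg b (Subsingleton.elim _ _)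
  | succ N ih =>
    have h1 : ∀ j : ι, b (Function.update E 0 (p j)) =
        ∑ k ∈ Fintype.piFinset (Fin.tail S), b (Fin.cons (p j) fun i => p (k i)) := by
      intro j
      have hc : IsAdditive (fun F : Fin N → Bdd Y => b (Fin.cons (p j) F)) := by
        intro F i A B h h'
        simp only [Fin.cons_update]
        exact hb _ i.succ A B (by simpa using h) h'
      rw [← ih hc (Fin.tail S) (Fin.tail E) (fun i => hE i.succ),
        ← Fin.cons_self_tail E, Fin.update_cons_zero, Fin.tail_cons]
    rw [hb.eq_sum_update p hp 0 (S 0) E (hE 0), Finset.sum_congr rfl fun j _ => h1 j,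
      ← Finset.sum_product']
    refine Finset.sum_nbij' (fun x => Fin.cons x.1 x.2) (fun j => (j 0, Fin.tail j)) ?_ ?_ ?_ ?_ ?_
    · rintro ⟨j, k⟩ h
      rw [Finset.mem_product, Fintype.mem_piFinset] at h
      exact Fintype.mem_piFinset.2 fun i => Fin.cases h.1 h.2 i
    · intro j h
      rw [Fintype.mem_piFinset] at h
      exact Finset.mem_product.2 ⟨h 0, Fintype.mem_piFinset.2 fun i => h i.succ⟩
    · rintro ⟨j, k⟩ -
      simp
    · intro j _
      simp
    · rintro ⟨j, k⟩ -
      refine congrArg b (funext fun i => ?_)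
      refine Fin.cases ?_ (fun _ => ?_) i <;> rfl

/-- Finitely many bounded sets are unions of members of one finite disjoint family. -/
theorem exists_common_partition (F : Finset (Bdd Y)) :
    ∃ (m : ℕ) (p : Fin m → Bdd Y) (S : Bdd Y → Finset (Fin m)),
      (∀ j k, j ≠ k → (p j).1 ∩ (p k).1 = ∅) ∧ ∀ A ∈ F, A.1 = ⋃ j ∈ S A, (p j).1 := by
  classical
  let ι := {J // J ∈ F.powerset.erase ∅}
  let q : ι → Bdd Y := fun J => ⟨{y | ∀ A ∈ F, y ∈ A.1 ↔ A ∈ J.1}, by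
    obtain ⟨J, hJ⟩ := J
    rw [Finset.mem_erase, Finset.mem_powerset] at hJ
    obtain ⟨A, hA⟩ := Finset.nonempty_iff_ne_empty.2 hJ.1
    exact Bdd.isCompact_closure_of_subset (A := A) fun y hy => (hy A (hJ.2 hA)).2 hA⟩
  let e := Fintype.equivFin ι
  refine ⟨Fintype.card ι, fun j => q (e.symm j),
    fun A => Finset.univ.filter fun j => A ∈ (e.symm j).1, fun j k hjk => ?_, fun A hA => ?_⟩
  · rw [Set.eq_empty_iff_forall_notMem]
    rintro y ⟨hj, hk⟩
    refine hjk (e.symm.injective (Subtype.ext (Finset.ext fun A => ?_)))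
    have hsub : ∀ J : ι, J.1 ⊆ F := fun J =>
      Finset.mem_powerset.1 (Finset.mem_of_mem_erase J.2)
    constructor
    · exact fun h => (hk A (hsub _ h)).1 ((hj A (hsub _ h)).2 h)
    · exact fun h => (hj A (hsub _ h)).1 ((hk A (hsub _ h)).2 h)
  · ext y
    simp only [Finset.mem_filter, Finset.mem_univ, true_and, Set.mem_iUnion, exists_prop]
    constructor
    · intro hy
      have hJ : F.filter (fun B => y ∈ B.1) ∈ F.powerset.erase ∅ := by
        rw [Finset.mem_erase, Finset.mem_powerset]
        exact ⟨Finset.nonempty_iff_ne_empty.1 ⟨A, Finset.mem_filter.2 ⟨hA, hy⟩⟩,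
          Finset.filter_subset _ _⟩
      refine ⟨e ⟨_, hJ⟩, ?_, ?_⟩
      · simp [hA, hy]
      · simp only [Equiv.symm_apply_apply]
        intro B hB
        simp [hB]
    · rintro ⟨j, hj, hy⟩
      exact (hy A hA).2 hj

/-- Each box splits into products of atoms, so a product of atoms acquires the total weight of the
boxes whose decomposition contains it. These weights do not depend on `b`, which allows a comparison
of different additive functions. -/
theorem IsAdditive.sum_smul_eq {N m : ℕ} {b : (Fin N → Bdd Y) → H} (hb : IsAdditive b)
    (p : Fin m → Bdd Y) (hp : ∀ j k, j ≠ k → (p j).1 ∩ (p k).1 = ∅)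
    (S : Bdd Y → Finset (Fin m)) (c : (Fin N → Bdd Y) →₀ ℤ)
    (hS : ∀ E ∈ c.support, ∀ i, (E i).1 = ⋃ j ∈ S (E i), (p j).1) :
    (c.sum fun E k => k • b E) =
      ∑ j : Fin N → Fin m,
        (∑ E ∈ c.support, if j ∈ Fintype.piFinset (fun i => S (E i)) then c E else 0) •
          b (fun i => p (j i)) := by
  simp_rw [Finset.sum_smul]
  rw [Finset.sum_comm, Finsupp.sum]
  refine Finset.sum_congr rfl fun E hE => ?_
  rw [hb.eq_sum_piFinset p hp (fun i => S (E i)) E (hS E hE), Finset.smul_sum]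
  simp only [ite_smul, zero_smul]
  rw [← Finset.sum_filter]
  refine Finset.sum_congr (by ext; simp) fun _ _ => rfl

end Additive

/-! ### Alternating indicators at tuples of ultrafilters -/

section UltraDet

variable {Y : Type u} [TopologicalSpace Y] {H : Type*} [AddCommGroup H]

open Classical in
/-- The alternating indicator of the box `E₀ × … × E_n` at a tuple of ultrafilters. -/
noncomputable def ultraDet {N : ℕ} (u : Fin N → Ultrafilter Y) (E : Fin N → Bdd Y) : ℤ :=
  (Matrix.of fun i l => if (E i).1 ∈ u l then (1 : ℤ) else 0).det

open Classical in
theorem ite_mem_ultrafilter_union {Z : Type*} (u : Ultrafilter Z) {A B C : Set Z} (h : C = A ∪ B)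
    (h' : A ∩ B = ∅) : (if C ∈ u then (1 : ℤ) else 0) =
      (if A ∈ u then 1 else 0) + if B ∈ u then 1 else 0 := by
  have hAB : ¬ (A ∈ u ∧ B ∈ u) := fun hh => by
    have := Filter.inter_mem hh.1 hh.2
    rw [h'] at this
    exact u.empty_notMem this
  rw [h, Ultrafilter.union_mem_iff]
  by_cases hA : A ∈ u <;> by_cases hB : B ∈ u <;> simp_all

/-- The determinant is linear in each row, and an ultrafilter containing a disjoint union contains
exactly one of the two parts. -/
theorem isAdditive_ultraDet {N : ℕ} (u : Fin N → Ultrafilter Y) : IsAdditive (ultraDet u) := by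
  classical
  intro E i A B h h'
  have key : ∀ C : Bdd Y, ultraDet u (Function.update E i C) =
      ((Matrix.of fun i l => if (E i).1 ∈ u l then (1 : ℤ) else 0).updateRow i
        fun l => if C.1 ∈ u l then (1 : ℤ) else 0).det := by
    intro C
    refine congrArg Matrix.det (Matrix.ext fun k l => ?_)
    by_cases hk : k = i
    · subst hk; simp
    · simp [hk]
  rw [key, key, ← Matrix.det_updateRow_add, ← Function.update_eq_self i E, key]
  congr 2
  · simp
  · funext l
    exact ite_mem_ultrafilter_union (u l) h h'

theorem ultraDet_perm {N : ℕ} (u : Fin N → Ultrafilter Y) (E : Fin N → Bdd Y)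
    (σ : Equiv.Perm (Fin N)) :
    ultraDet u (fun i => E (σ i)) = (Equiv.Perm.sign σ : ℤ) • ultraDet u E := by
  classical
  exact Matrix.det_permute σ (Matrix.of fun i l => if (E i).1 ∈ u l then (1 : ℤ) else 0)

theorem ultraDet_alt {N : ℕ} (u : Fin N → Ultrafilter Y) {E : Fin N → Bdd Y} {i j : Fin N}
    (h : i ≠ j) (h' : E i = E j) : ultraDet u E = 0 := by
  classical
  exact Matrix.det_zero_of_row_eq h (funext fun l => by simp [h'])

/-- The common limit gives the support condition: if the closure of `E i` misses `y`, no ultrafilter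
converging to `y` contains `E i`, and row `i` is zero. -/
theorem isChain_ultraDet {n : ℕ} {u : Fin (n + 1) → Ultrafilter Y} {y : Y}
    (hu : ∀ l, (u l : Filter Y) ≤ 𝓝 y) : IsChain (ultraDet u) := by
  classical
  refine ⟨isAdditive_ultraDet u, ultraDet_perm u, fun E i j h h' => ultraDet_alt u h h',
    fun E h => ?_⟩
  have : ∃ i, y ∉ closure (E i).1 := by
    by_contra! hc
    exact (Set.eq_empty_iff_forall_notMem.1 h) y (Set.mem_iInter.2 hc)
  obtain ⟨i, hi⟩ := this
  refine Matrix.det_eq_zero_of_row_eq_zero i fun l => ?_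
  simp only [Matrix.of_apply, ite_eq_right_iff, one_ne_zero, imp_false]
  exact fun hm => hi (mem_closure_iff_ultrafilter.2 ⟨u l, hm, hu l⟩)

/-- A linear relation that holds between the alternating indicators of boxes at all tuples of
ultrafilters in `Θ` also holds for the values of a chain that vanishes on boxes missing `Θ`. -/
theorem IsChain.sum_smul_eq_zero {n : ℕ} {b : (Fin (n + 1) → Bdd Y) → H} (hb : IsChain b)
    (Θ : Set (Fin (n + 1) → Ultrafilter Y))
    (hΘ : ∀ E, (∀ u ∈ Θ, ∃ i, (E i).1 ∉ u i) → b E = 0)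
    (c : (Fin (n + 1) → Bdd Y) →₀ ℤ)
    (hc : ∀ u ∈ Θ, (c.sum fun E k => k • ultraDet u E) = 0) :
    (c.sum fun E k => k • b E) = 0 := by
  classical
  obtain ⟨m, p, S, hp, hS⟩ :=
    exists_common_partition (c.support.biUnion fun E => Finset.univ.image E)
  have hS' : ∀ E ∈ c.support, ∀ i, (E i).1 = ⋃ j ∈ S (E i), (p j).1 := fun E hE i =>
    hS (E i) (Finset.mem_biUnion.2 ⟨E, hE, Finset.mem_image_of_mem _ (Finset.mem_univ _)⟩)
  set C : (Fin (n + 1) → Fin m) → ℤ := fun j =>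
    ∑ E ∈ c.support, if j ∈ Fintype.piFinset (fun i => S (E i)) then c E else 0 with hC
  have hb_alt : ∀ j : Fin (n + 1) → Fin m, ¬ Function.Injective j → b (fun i => p (j i)) = 0 := by
    intro j hj
    simp only [Function.Injective, not_forall] at hj
    obtain ⟨i, k, h, hne⟩ := hj
    exact hb.alt _ i k hne (congrArg p h)
  rw [IsAdditive.sum_smul_eq hb.add p hp S c hS']
  change ∑ j, C j • b (fun i => p (j i)) = 0
  rw [sum_smul_eq_sum_strictMono C (fun j => b fun i => p (j i))
    (fun j σ => hb.perm (fun i => p (j i)) σ) hb_alt]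
  refine Finset.sum_eq_zero fun s _ => ?_
  -- Either `b` kills this tuple of atoms, or some `u` in `Θ` has each atom `p (s i)` in `u i`;
  -- evaluating the relation at that `u` isolates the coefficient of `s`.
  by_cases hs : ∀ u ∈ Θ, ∃ i, (p (s.1 i)).1 ∉ u i
  · rw [hΘ _ hs, smul_zero]
  push Not at hs
  obtain ⟨u, hu, hmem⟩ := hs
  have h0 := hc u hu
  rw [IsAdditive.sum_smul_eq (isAdditive_ultraDet u) p hp S c hS'] at h0
  change ∑ j, C j • ultraDet u (fun i => p (j i)) = 0 at h0
  rw [sum_smul_eq_sum_strictMono C (fun j => ultraDet u fun i => p (j i))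
    (fun j σ => ultraDet_perm u (fun i => p (j i)) σ) (fun j hj => by
      simp only [Function.Injective, not_forall] at hj
      obtain ⟨i, k, h, hne⟩ := hj
      exact ultraDet_alt u hne (congrArg p h))] at h0
  -- Disjoint atoms cannot lie in the same ultrafilter, so `p (s l)` is the only atom in `u l`, and
  -- the matrix records the coincidences of `t` with `s`.
  have hdet : ∀ t : {t : Fin (n + 1) → Fin m // StrictMono t},
      ultraDet u (fun i => p (t.1 i)) = if t.1 = s.1 then 1 else 0 := by
    intro t
    rw [← det_strictMono t.2 s.2]
    refine congrArg Matrix.det (Matrix.ext fun i l => ?_)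
    simp only [Matrix.of_apply]
    refine if_congr ⟨fun hm => ?_, fun e => e ▸ hmem l⟩ rfl rfl
    by_contra hne
    have := Filter.inter_mem hm (hmem l)
    rw [hp _ _ hne] at this
    exact (u l).empty_notMem this
  simp only [hdet] at h0
  rw [Finset.sum_eq_single s (fun t _ hne => by
    rw [if_neg fun e => hne (Subtype.ext e), smul_zero]) (by simp)] at h0
  simp only [if_true, smul_eq_mul, mul_one] at h0
  rw [h0, zero_smul]

end UltraDet

/-! ### Change of coefficients -/

section Coefficients

variable {Y : Type u} [TopologicalSpace Y] {H H' : Type*} [AddCommGroup H] [AddCommGroup H']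

theorem IsChain.map {n : ℕ} {b : (Fin (n + 1) → Bdd Y) → H} (hb : IsChain b) (φ : H →+ H') :
    IsChain (fun E => φ (b E)) :=
  ⟨fun E i A B h h' => by rw [hb.add E i A B h h', map_add],
    fun E σ => by rw [hb.perm E σ, map_zsmul],
    fun E i j h h' => by rw [hb.alt E i j h h', map_zero],
    fun E h => by rw [hb.supp E h, map_zero]⟩

theorem IsChain.of_map_injective {n : ℕ} {b : (Fin (n + 1) → Bdd Y) → H} (φ : H →+ H')
    (hφ : Function.Injective φ) (hb : IsChain (fun E => φ (b E))) : IsChain b :=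
  ⟨fun E i A B h h' => hφ (by rw [map_add]; exact hb.add E i A B h h'),
    fun E σ => hφ (by rw [map_zsmul]; exact hb.perm E σ),
    fun E i j h h' => hφ (by rw [map_zero]; exact hb.alt E i j h h'),
    fun E h => hφ (by rw [map_zero]; exact hb.supp E h)⟩

theorem IsChain.pi {n : ℕ} {ι : Type*} {b : (Fin (n + 1) → Bdd Y) → ι → H}
    (hb : ∀ t, IsChain (fun E => b E t)) : IsChain b :=
  ⟨fun E i A B h h' => funext fun t => (hb t).add E i A B h h',
    fun E σ => funext fun t => (hb t).perm E σ,
    fun E i j h h' => funext fun t => (hb t).alt E i j h h',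
    fun E h => funext fun t => (hb t).supp E h⟩

end Coefficients

/-! ### Locality of chains -/

section Locality

variable {Y : Type u} [TopologicalSpace Y] {H : Type*} [AddCommGroup H]

/-- The intersection of a bounded set with an arbitrary set. -/
def Bdd.inter (E : Bdd Y) (V : Set Y) : Bdd Y :=
  ⟨E.1 ∩ V, Bdd.isCompact_closure_of_subset (A := E) Set.inter_subset_left⟩

/-- The value of a chain only depends on the traces of the arguments on a neighbourhood of the
closure of one of them. -/
theorem IsChain.eq_inter {n : ℕ} {b : (Fin (n + 1) → Bdd Y) → H} (hb : IsChain b) {V : Set Y}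
    (hV : IsOpen V) (E : Fin (n + 1) → Bdd Y) (i : Fin (n + 1)) (hi : closure (E i).1 ⊆ V) :
    b E = b (fun j => (E j).inter V) := by
  classical
  have key : ∀ s : Finset (Fin (n + 1)),
      b E = b (fun j => if j ∈ s then (E j).inter V else E j) := by
    intro s
    induction s using Finset.induction_on with
    | empty => simp
    | insert a s ha ih =>
      have hc : IsCompact (closure ((E a).1 \ V)) :=
        Bdd.isCompact_closure_of_subset (A := E a) Set.sdiff_subset
      rw [ih, hb.add _ a ((E a).inter V) ⟨_, hc⟩
        (by simp [ha, Bdd.inter, Set.inter_union_sdiff])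
        (by
          rw [Set.eq_empty_iff_forall_notMem]
          exact fun x hx => hx.2.2 hx.1.2)]
      -- The part of `E a` outside the open set `V` has closure outside `V`, hence disjoint from the
      -- closure of `E i`.
      rw [hb.supp (Function.update _ a ⟨_, hc⟩), add_zero]
      · congr 1
        funext j
        by_cases hj : j = a
        · subst hj; simp
        · simp [hj]
      · rw [Set.eq_empty_iff_forall_notMem]
        intro x hx
        rw [Set.mem_iInter] at hx
        have h1 : x ∈ closure ((E a).1 \ V) := by simpa using hx a
        have h2 : x ∈ closure (E i).1 := by
          refine closure_mono ?_ (hx i)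
          by_cases hia : i = a
          · subst hia
            rw [Function.update_self]
            exact Set.sdiff_subset
          · rw [Function.update_of_ne hia]
            split_ifs
            · exact Set.inter_subset_left
            · exact subset_rfl
        exact closure_minimal (fun y hy => hy.2) hV.isClosed_compl h1 (hi h2)
  simpa using key Finset.univ

variable {X : Type u} [TopologicalSpace X] [LocallyCompactSpace X] [T2Space X]

/-- A chain on the one-point compactification whose restriction vanishes is concentrated at the
point at infinity. -/
theorem eq_zero_of_restrict_eq_zero {n : ℕ} (F : chains (OnePoint X) H n)
    (hF : restrict H ((↑) : X → OnePoint X) OnePoint.isOpenEmbedding_coe n F = 0)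
    (E : Fin (n + 1) → Bdd (OnePoint X)) (i : Fin (n + 1))
    (hi : OnePoint.infty ∉ closure (E i).1) : F.1 E = 0 := by
  -- The closure of `E i` avoids infinity, so it is a compact subset of `X` and has a relatively
  -- compact open neighbourhood `V` in `X`. Traces on `V` are bounded in `X`, where `F` vanishes.
  set K : Set X := (↑) ⁻¹' closure (E i).1 with hK
  have hKE : ((↑) : X → OnePoint X) '' K = closure (E i).1 := by
    rw [hK, Set.image_preimage_eq_iff]
    intro y hy
    rw [← OnePoint.compl_infty]
    rintro rfl
    exact hi hy
  have hKc : IsCompact K :=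
    (OnePoint.isClosed_image_coe.1 (by rw [hKE]; exact isClosed_closure)).2
  obtain ⟨V, hV, hKV, hVc⟩ := exists_isOpen_superset_and_isCompact_closure hKc
  rw [IsChain.eq_inter F.2 (V := ((↑) : X → OnePoint X) '' V)
    (OnePoint.isOpenEmbedding_coe.isOpenMap _ hV) E i (hKE ▸ Set.image_mono hKV)]
  have h := congrFun (congrArg Subtype.val hF) fun j =>
    ⟨((↑) : X → OnePoint X) ⁻¹' (E j).1 ∩ V,
      Bdd.isCompact_closure_of_subset (A := ⟨V, hVc⟩) Set.inter_subset_right⟩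
  refine Eq.trans (congrArg F.1 (funext fun j => Subtype.ext ?_)) h
  exact (Set.image_preimage_inter _ _ _).symm

end Locality

/-! ### Germs of sets at a point -/

section LimitUltrafilters

variable {Y : Type u} [TopologicalSpace Y]

/-- The ultrafilters converging to `y`. -/
abbrev LimUltra (y : Y) : Type u := {u : Ultrafilter Y // (u : Filter Y) ≤ 𝓝 y}

/-- Convergence to `y` is the conjunction of the clopen conditions `s ∈ u` over the neighbourhoods
`s` of `y`. The limit ultrafilters thus form a profinite space. -/
theorem isClosed_limUltra (y : Y) : IsClosed {u : Ultrafilter Y | (u : Filter Y) ≤ 𝓝 y} := by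
  have : {u : Ultrafilter Y | (u : Filter Y) ≤ 𝓝 y} = ⋂ s ∈ 𝓝 y, {u | s ∈ u} := by
    ext u
    simp [Filter.le_def]
  rw [this]
  exact isClosed_biInter fun s _ => ultrafilter_isClosed_basic s

instance compactSpace_limUltra (y : Y) : CompactSpace (LimUltra y) :=
  isCompact_iff_compactSpace.1 (isClosed_limUltra y).isCompact

/-- Nöbeling's theorem. Freeness passes to the exterior powers and is what makes the wedges at
infinity liftable. -/
instance free_locallyConstant_limUltra (y : Y) :
    Module.Free ℤ (LocallyConstant (LimUltra y) ℤ) :=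
  LocallyConstant.freeOfProfinite (Profinite.of (LimUltra y))

theorem isClopen_limUltra (y : Y) (E : Set Y) : IsClopen {u : LimUltra y | E ∈ u.1} :=
  IsClopen.preimage ⟨ultrafilter_isClosed_basic E, ultrafilter_isOpen_basic E⟩
    continuous_subtype_val

/-- By compactness a clopen set is a finite union of basic ones, and an ultrafilter contains a
finite union exactly when it contains one of its members. -/
theorem exists_eq_of_isClopen_limUltra {y : Y} {C : Set (LimUltra y)} (hC : IsClopen C) :
    ∃ E : Set Y, C = {u | E ∈ u.1} := by
  have hb : TopologicalSpace.IsTopologicalBasis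
      (Set.range fun E : Set Y => {u : LimUltra y | E ∈ u.1}) := by
    have := isTopologicalBasis_subtype (ultrafilterBasis_is_basis (α := Y))
      (fun u => (u : Filter Y) ≤ 𝓝 y)
    rw [ultrafilterBasis, ← Set.range_comp] at this
    exact this
  obtain ⟨s, hs, h⟩ := eq_finite_iUnion_of_isTopologicalBasis_of_isCompact_open _ hb C
    hC.isClosed.isCompact hC.isOpen
  refine ⟨⋃ E ∈ s, E, ?_⟩
  ext u
  rw [h]
  simp only [Set.mem_iUnion, Set.mem_ofPred_eq, exists_prop]
  exact (Ultrafilter.finite_biUnion_mem_iff hs).symm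

/-- The indicator function of a set on the ultrafilters converging to `y`. -/
noncomputable def limInd (y : Y) (E : Set Y) : LocallyConstant (LimUltra y) ℤ :=
  LocallyConstant.charFn ℤ (isClopen_limUltra y E)

open Classical in
theorem limInd_apply (y : Y) (E : Set Y) (u : LimUltra y) :
    limInd y E u = if E ∈ u.1 then 1 else 0 := by
  simp [limInd, LocallyConstant.coe_charFn, Set.indicator_apply]

theorem limInd_union (y : Y) {A B C : Set Y} (h : C = A ∪ B) (h' : A ∩ B = ∅) :
    limInd y C = limInd y A + limInd y B := by
  classical
  ext u
  simp only [LocallyConstant.coe_add, Pi.add_apply, limInd_apply]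
  exact ite_mem_ultrafilter_union u.1 h h'

theorem limInd_eq_zero {y : Y} {E : Set Y} (h : y ∉ closure E) : limInd y E = 0 := by
  classical
  ext u
  rw [limInd_apply, if_neg fun hu => h (mem_closure_iff_ultrafilter.2 ⟨u.1, hu, u.2⟩)]
  rfl

theorem span_range_limInd (y : Y) : Submodule.span ℤ (Set.range (limInd y)) = ⊤ := by
  classical
  rw [eq_top_iff]
  intro g _
  have hg : g = ∑ k ∈ g.range_finite.toFinset,
      k • LocallyConstant.charFn ℤ (g.isLocallyConstant.isClopen_fiber k) := by
    ext u
    have : ∀ k : ℤ, (k • LocallyConstant.charFn ℤ (g.isLocallyConstant.isClopen_fiber k)) u =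
        if k = g u then k else 0 := by
      intro k
      rw [LocallyConstant.coe_smul, Pi.smul_apply, LocallyConstant.coe_charFn, Set.indicator_apply]
      simp [eq_comm]
    rw [← LocallyConstant.evalₗ_apply ℤ u (∑ k ∈ _, _), map_sum]
    simp only [LocallyConstant.evalₗ_apply, this]
    rw [Finset.sum_ite_eq', if_pos (by simp)]
  rw [hg]
  refine Submodule.sum_mem _ fun k _ => Submodule.smul_mem _ _ ?_
  obtain ⟨E, hE⟩ := exists_eq_of_isClopen_limUltra (g.isLocallyConstant.isClopen_fiber k)
  refine Submodule.subset_span ⟨E, ?_⟩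
  ext u
  simp only [limInd, LocallyConstant.coe_charFn]
  rw [hE]

/-- The exterior product of the indicators of a tuple of sets at `y`. -/
noncomputable def limWedge (y : Y) {n : ℕ} (E : Fin (n + 1) → Bdd Y) :
    ⋀[ℤ]^(n + 1) (LocallyConstant (LimUltra y) ℤ) :=
  exteriorPower.ιMulti ℤ (n + 1) fun i => limInd y (E i).1

theorem limWedge_eq_zero {y : Y} {n : ℕ} {E : Fin (n + 1) → Bdd Y} {i : Fin (n + 1)}
    (h : y ∉ closure (E i).1) : limWedge y E = 0 :=
  (exteriorPower.ιMulti ℤ (n + 1)).map_coord_zero i (limInd_eq_zero h)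

theorem isChain_limWedge (y : Y) (n : ℕ) :
    IsChain (limWedge y : (Fin (n + 1) → Bdd Y) → _) := by
  have key : ∀ (E : Fin (n + 1) → Bdd Y) (i : Fin (n + 1)) (A : Bdd Y),
      limWedge y (Function.update E i A) = exteriorPower.ιMulti ℤ (n + 1)
        (Function.update (fun j => limInd y (E j).1) i (limInd y A.1)) := by
    intro E i A
    refine congrArg (exteriorPower.ιMulti ℤ (n + 1)) (funext fun j => ?_)
    by_cases hj : j = i
    · subst hj; simp
    · simp [hj]
  refine ⟨fun E i A B h h' => ?_, fun E σ => ?_, fun E i j h h' => ?_, fun E h => ?_⟩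
  · rw [key, key, ← AlternatingMap.map_update_add, ← limInd_union y h h',
      Function.update_eq_self i (fun j => limInd y (E j).1)]
    rfl
  · exact (exteriorPower.ιMulti ℤ (n + 1)).map_perm (fun i => limInd y (E i).1) σ
  · exact (exteriorPower.ιMulti ℤ (n + 1)).map_eq_zero_of_eq _ (by simp [h']) h
  · have : ∃ i, y ∉ closure (E i).1 := by
      by_contra! hc
      exact (Set.eq_empty_iff_forall_notMem.1 h) y (Set.mem_iInter.2 hc)
    obtain ⟨i, hi⟩ := this
    exact limWedge_eq_zero hi

/-- The wedge determines the alternating indicator at every tuple of ultrafilters converging to `y`,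
so a relation among wedges yields one among indicators. -/
theorem ultraDet_eq_limWedge (y : Y) {n : ℕ} (u : Fin (n + 1) → LimUltra y)
    (E : Fin (n + 1) → Bdd Y) :
    exteriorPower.alternatingMapToDual ℤ _ (n + 1)
      (fun l => LocallyConstant.evalₗ ℤ (u l)) (limWedge y E) = ultraDet (fun l => (u l).1) E := by
  classical
  rw [limWedge, exteriorPower.alternatingMapToDual_apply_ιMulti]
  refine congrArg Matrix.det (Matrix.ext fun i l => ?_)
  simp only [Matrix.of_apply, LocallyConstant.evalₗ_apply, limInd_apply]

/-- Indicators of sets span the locally constant functions, so their wedges span the exterior power;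
compactness of `Y` makes all these sets bounded. -/
theorem linearCombination_limWedge_surjective [CompactSpace Y] (y : Y) (n : ℕ) :
    Function.Surjective (Finsupp.linearCombination ℤ
      (limWedge y : (Fin (n + 1) → Bdd Y) → _)) := by
  rw [← LinearMap.range_eq_top, Finsupp.range_linearCombination, eq_top_iff,
    ← exteriorPower.ιMulti_span_of_span ℤ (n + 1) _ (span_range_limInd y)]
  refine Submodule.span_mono ?_
  rintro _ ⟨a, ha, rfl⟩
  have : ∀ i, ∃ E : Set Y, limInd y E = a i := fun i => ha ⟨i, rfl⟩
  choose E hE using this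
  exact ⟨fun i => ⟨E i, isClosed_closure.isCompact⟩,
    congrArg (exteriorPower.ιMulti ℤ (n + 1)) (funext hE)⟩

end LimitUltrafilters

/-! ### Extending chains over the point at infinity -/

section Extension

/-- The tuples of ultrafilters with a common limit. -/
def commonLim (Y : Type u) [TopologicalSpace Y] (N : ℕ) : Set (Fin N → Ultrafilter Y) :=
  {u | ∃ y, ∀ l, (u l : Filter Y) ≤ 𝓝 y}

/-- The alternating indicator of a box, as a function on the tuples with a common limit. -/
noncomputable def boxInd (Y : Type u) [TopologicalSpace Y] (N : ℕ) (E : Fin N → Bdd Y) :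
    commonLim Y N → ℤ :=
  fun u => ultraDet u.1 E

theorem isChain_boxInd (Y : Type u) [TopologicalSpace Y] (n : ℕ) :
    IsChain (boxInd Y (n + 1)) :=
  IsChain.pi fun u => isChain_ultraDet u.2.choose_spec

theorem exists_mem_commonLim {Y : Type u} [TopologicalSpace Y] {N : ℕ} {E : Fin N → Bdd Y} {y : Y}
    (h : ∀ i, y ∈ closure (E i).1) :
    ∃ u : Fin N → Ultrafilter Y, (∀ l, (u l : Filter Y) ≤ 𝓝 y) ∧ ∀ i, (E i).1 ∈ u i := by
  choose u hu hy using fun i => mem_closure_iff_ultrafilter.1 (h i)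
  exact ⟨u, hy, hu⟩

variable {X : Type u} [TopologicalSpace X] [LocallyCompactSpace X] [T2Space X]
  {G : Type v} [AddCommGroup G]

theorem ultraDet_image {N : ℕ} (u : Fin N → Ultrafilter X) (E : Fin N → Bdd X) :
    ultraDet (fun l => (u l).map ((↑) : X → OnePoint X))
      (fun i => Bdd.image _ OnePoint.continuous_coe (E i)) = ultraDet u E := by
  classical
  refine congrArg Matrix.det (Matrix.ext fun i l => ?_)
  simp only [Matrix.of_apply, Ultrafilter.mem_map, Bdd.image,
    Set.preimage_image_eq _ OnePoint.coe_injective]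

/-- Linear relations between the alternating indicators on the one-point compactification of boxes
of bounded subsets of `X` hold for the values of every chain on `X`. -/
theorem ker_boxInd_image_le {n : ℕ} (f : chains X G n) :
    LinearMap.ker (Finsupp.linearCombination ℤ fun E : Fin (n + 1) → Bdd X =>
      boxInd (OnePoint X) (n + 1) fun i => Bdd.image _ OnePoint.continuous_coe (E i)) ≤
    LinearMap.ker (Finsupp.linearCombination ℤ f.1) := by
  intro c hc
  rw [LinearMap.mem_ker, Finsupp.linearCombination_apply] at hc ⊢
  refine IsChain.sum_smul_eq_zero f.2 (commonLim X (n + 1)) (fun E h => f.2.supp E ?_) c ?_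
  · rw [Set.eq_empty_iff_forall_notMem]
    intro x hx
    obtain ⟨u, hu, hE⟩ := exists_mem_commonLim (Set.mem_iInter.1 hx)
    obtain ⟨i, hi⟩ := h u ⟨x, hu⟩
    exact hi (hE i)
  · rintro u ⟨x, hx⟩
    have hu : (fun l => (u l).map ((↑) : X → OnePoint X)) ∈ commonLim (OnePoint X) (n + 1) :=
      ⟨x, fun l => (Filter.map_mono (hx l)).trans OnePoint.continuous_coe.continuousAt⟩
    have h := congrFun hc ⟨_, hu⟩
    simp only [Finsupp.sum, Finset.sum_apply, Pi.smul_apply, boxInd, ultraDet_image] at h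
    exact h

/-- A combination of boxes that is trivial at infinity has the same alternating indicator as a
combination of boxes of bounded subsets of `X`. -/
theorem linearCombination_boxInd_mem {n : ℕ} {c : (Fin (n + 1) → Bdd (OnePoint X)) →₀ ℤ}
    (hc : Finsupp.linearCombination ℤ (limWedge OnePoint.infty) c = 0) :
    Finsupp.linearCombination ℤ (boxInd (OnePoint X) (n + 1)) c ∈
      LinearMap.range (Finsupp.linearCombination ℤ fun E : Fin (n + 1) → Bdd X =>
        boxInd (OnePoint X) (n + 1) fun i => Bdd.image _ OnePoint.continuous_coe (E i)) := by
  set P := LinearMap.range (Finsupp.linearCombination ℤ fun E : Fin (n + 1) → Bdd X =>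
        boxInd (OnePoint X) (n + 1) fun i => Bdd.image _ OnePoint.continuous_coe (E i)) with hP
  -- The indicator modulo `P` is a chain with coefficients in the quotient. It vanishes on `X`,
  -- hence is concentrated at infinity, and only ultrafilters converging there test its relations.
  have hb : IsChain fun E => P.mkQ.toAddMonoidHom (boxInd (OnePoint X) (n + 1) E) :=
    (isChain_boxInd (OnePoint X) n).map P.mkQ.toAddMonoidHom
  have hr : restrict _ ((↑) : X → OnePoint X) OnePoint.isOpenEmbedding_coe n ⟨_, hb⟩ = 0 := by
    refine Subtype.ext (funext fun E => ?_)
    refine (Submodule.Quotient.mk_eq_zero P).2 ⟨Finsupp.single E 1, ?_⟩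
    simp
  have h0 := hb.sum_smul_eq_zero {u | ∀ l, (u l : Filter (OnePoint X)) ≤ 𝓝 OnePoint.infty} ?_ c ?_
  · rw [← Submodule.Quotient.mk_eq_zero, ← Submodule.mkQ_apply,
      Finsupp.linearCombination_apply, Finsupp.sum, map_sum]
    simp only [map_zsmul]
    exact h0
  · intro E hE
    by_contra hne
    have : ∀ i, OnePoint.infty ∈ closure (E i).1 := by
      by_contra! hcon
      obtain ⟨i, hi⟩ := hcon
      exact hne (eq_zero_of_restrict_eq_zero ⟨_, hb⟩ hr E i hi)
    obtain ⟨u, hu, hm⟩ := exists_mem_commonLim this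
    obtain ⟨i, hi⟩ := hE u hu
    exact hi (hm i)
  · intro u hu
    have h := congrArg (exteriorPower.alternatingMapToDual ℤ _ (n + 1)
      (fun l => LocallyConstant.evalₗ ℤ (⟨u l, hu l⟩ : LimUltra (OnePoint.infty : OnePoint X)))) hc
    rw [map_zero, Finsupp.linearCombination_apply, Finsupp.sum, map_sum] at h
    simp only [map_zsmul, ultraDet_eq_limWedge] at h
    exact h

/-- Every chain on `X` extends to the one-point compactification. -/
theorem restrict_surjective (n : ℕ) : Function.Surjective
    (restrict G ((↑) : X → OnePoint X) OnePoint.isOpenEmbedding_coe n) := by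
  intro f
  let A := Finsupp.linearCombination ℤ (boxInd (OnePoint X) (n + 1))
  let A₀ := Finsupp.linearCombination ℤ fun E : Fin (n + 1) → Bdd X =>
    boxInd (OnePoint X) (n + 1) fun i => Bdd.image _ OnePoint.continuous_coe (E i)
  let W := Finsupp.linearCombination ℤ
    (limWedge OnePoint.infty : (Fin (n + 1) → Bdd (OnePoint X)) → _)
  -- A linear section of `W`, available because the exterior power is free.
  obtain ⟨s, hs⟩ := Module.projective_lifting_property W LinearMap.id
    (linearCombination_limWedge_surjective (OnePoint.infty : OnePoint X) n)
  let φ : LinearMap.range A₀ →ₗ[ℤ] G :=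
    (LinearMap.ker A₀).liftQ (Finsupp.linearCombination ℤ f.1) (ker_boxInd_image_le f) ∘ₗ
      A₀.quotKerEquivRange.symm.toLinearMap
  have hφ : ∀ E : Fin (n + 1) → Bdd X, ∀ h, φ ⟨boxInd (OnePoint X) (n + 1) fun i =>
      Bdd.image _ OnePoint.continuous_coe (E i), h⟩ = f.1 E := by
    intro E h
    have h1 : (⟨_, h⟩ : LinearMap.range A₀) =
        A₀.quotKerEquivRange ((LinearMap.ker A₀).mkQ (Finsupp.single E 1)) := by
      refine Subtype.ext ?_
      simp [A₀]
    rw [h1]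
    simp [φ]
  have hmem : ∀ E : Fin (n + 1) → Bdd (OnePoint X),
      boxInd (OnePoint X) (n + 1) E - A (s (limWedge OnePoint.infty E)) ∈ LinearMap.range A₀ := by
    intro E
    have h1 : boxInd (OnePoint X) (n + 1) E - A (s (limWedge OnePoint.infty E)) =
        A (Finsupp.single E 1 - s (limWedge OnePoint.infty E)) := by
      simp [A]
    rw [h1]
    refine linearCombination_boxInd_mem ?_
    have h2 := LinearMap.congr_fun hs (limWedge OnePoint.infty E)
    simp only [LinearMap.comp_apply, LinearMap.id_apply, W] at h2
    rw [map_sub, h2]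
    simp
  have hch : IsChain fun E : Fin (n + 1) → Bdd (OnePoint X) =>
      (⟨_, hmem E⟩ : LinearMap.range A₀) := by
    refine IsChain.of_map_injective (LinearMap.range A₀).subtype.toAddMonoidHom
      Subtype.val_injective ?_
    exact (chains (OnePoint X) _ n).sub_mem (isChain_boxInd (OnePoint X) n)
      ((isChain_limWedge OnePoint.infty n).map (A ∘ₗ s).toAddMonoidHom)
  refine ⟨⟨_, hch.map φ.toAddMonoidHom⟩, Subtype.ext (funext fun E => ?_)⟩
  refine Eq.trans ?_ (hφ E ⟨Finsupp.single E 1, by simp [A₀]⟩)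
  refine congrArg φ (Subtype.ext ?_)
  -- A bounded subset of `X` has trivial germ at infinity, so the correction term disappears and the
  -- extension restricts to `f`.
  change boxInd (OnePoint X) (n + 1) _ - A (s (limWedge OnePoint.infty _)) = _
  rw [limWedge_eq_zero (i := 0), map_zero, map_zero, sub_zero]
  rw [Bdd.closure_image]
  exact OnePoint.infty_notMem_image_coe

end Extension

/-! ### Cones over chains -/

section Cone

variable {Y : Type u} [TopologicalSpace Y] {H : Type*} [AddCommGroup H]

/-- `τ` is `σ` with the point `k` and its image deleted. Cycling `k` and `σ k` to the front turns
`σ` into a permutation fixing `0`, and the two cycles account for the powers of `-1`. -/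
theorem exists_perm_succAbove {n : ℕ} (σ : Equiv.Perm (Fin (n + 1))) (k : Fin (n + 1)) :
    ∃ τ : Equiv.Perm (Fin n), (∀ i, σ (k.succAbove i) = (σ k).succAbove (τ i)) ∧
      (Equiv.Perm.sign τ : ℤ) = (-1) ^ (σ k : ℕ) * Equiv.Perm.sign σ * (-1) ^ (k : ℕ) := by
  set ρ : Equiv.Perm (Fin (n + 1)) := (σ k).cycleRange * σ * k.cycleRange⁻¹ with hρ
  have hσ : ∀ i, σ (k.succAbove i) = (σ k).cycleRange.symm (ρ i.succ) := by
    intro i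
    simp [hρ, ← Fin.cycleRange_symm_succ]
  have h0 : ρ 0 = 0 := by
    simp [hρ]
  obtain ⟨⟨q, τ⟩, hτ⟩ := Equiv.Perm.decomposeFin.symm.surjective ρ
  have hq : q = 0 := by
    rw [← hτ] at h0
    simpa using h0
  subst hq
  refine ⟨τ, fun i => ?_, ?_⟩
  · rw [hσ, ← hτ]
    simp
  · have h1 := congrArg Equiv.Perm.sign hτ
    rw [Equiv.Perm.decomposeFin.symm_sign, if_pos rfl, one_mul] at h1
    rw [h1, hρ]
    simp [Fin.sign_cycleRange]

open Classical in
/-- The terms of the cone of `b` with vertex `y`. -/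
noncomputable def coneTerm (y : Y) {n : ℕ} (b : (Fin n → Bdd Y) → H) (E : Fin (n + 1) → Bdd Y)
    (k : Fin (n + 1)) : H :=
  if y ∈ (E k).1 then (-1 : ℤ) ^ (k : ℕ) • b (fun i => E (k.succAbove i)) else 0

/-- The cone of `b` with vertex `y`. -/
noncomputable def cone (y : Y) {n : ℕ} (b : (Fin n → Bdd Y) → H) (E : Fin (n + 1) → Bdd Y) : H :=
  ∑ k, coneTerm y b E k

theorem coneTerm_perm (y : Y) {n : ℕ} {b : (Fin (n + 1) → Bdd Y) → H} (hb : IsChain b)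
    (E : Fin (n + 1 + 1) → Bdd Y) (σ : Equiv.Perm (Fin (n + 1 + 1))) (k : Fin (n + 1 + 1)) :
    coneTerm y b (fun i => E (σ i)) k =
      (Equiv.Perm.sign σ : ℤ) • coneTerm y b E (σ k) := by
  obtain ⟨τ, hτ, hs⟩ := exists_perm_succAbove σ k
  unfold coneTerm
  split_ifs
  · simp only [hτ]
    rw [hb.perm (fun i => E ((σ k).succAbove i)) τ, hs, smul_smul, smul_smul]
    congr 1
    have : (-1 : ℤ) ^ (k : ℕ) * (-1) ^ (k : ℕ) = 1 := by rw [← mul_pow]; simp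
    linear_combination ((-1 : ℤ) ^ (σ k : ℕ) * (Equiv.Perm.sign σ : ℤ)) * this
  · rw [smul_zero]

/-- The hypothesis `hy` serves the support condition. A term is nonzero only if `y` lies in the
omitted argument and in the closures of all the others, thus in every closure. -/
theorem isChain_cone {y : Y} {n : ℕ} {b : (Fin (n + 1) → Bdd Y) → H} (hb : IsChain b)
    (hy : ∀ E i, y ∉ closure (E i).1 → b E = 0) : IsChain (cone y b) := by
  refine ⟨fun E i A B h h' => ?_, fun E σ => ?_, fun E i j h h' => ?_, fun E h => ?_⟩
  · unfold cone
    rw [← Finset.sum_add_distrib]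
    refine Finset.sum_congr rfl fun k _ => ?_
    unfold coneTerm
    by_cases hk : i = k
    · subst hk
      have hne : ∀ C : Bdd Y, (fun l => Function.update E i C (i.succAbove l)) =
          fun l => E (i.succAbove l) := fun C => funext fun l =>
        Function.update_of_ne (Fin.succAbove_ne i l) _ _
      simp only [hne, Function.update_self, h, Set.mem_union]
      have hAB : ¬ (y ∈ A.1 ∧ y ∈ B.1) := fun hh => by
        have : y ∈ A.1 ∩ B.1 := hh
        rw [h'] at this
        exact this
      by_cases hA : y ∈ A.1 <;> by_cases hB : y ∈ B.1 <;> simp_all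
    · obtain ⟨l, rfl⟩ := Fin.exists_succAbove_eq hk
      have hup : ∀ C : Bdd Y, (fun m => Function.update E (k.succAbove l) C (k.succAbove m)) =
          Function.update (fun m => E (k.succAbove m)) l C := by
        intro C
        funext m
        by_cases hm : m = l
        · subst hm; simp
        · simp [hm]
      have hke : ∀ C : Bdd Y, Function.update E (k.succAbove l) C k = E k := fun C =>
        Function.update_of_ne (Ne.symm hk) _ _
      by_cases hm : y ∈ (E k).1
      · rw [if_pos hm, if_pos (by rwa [hke]), if_pos (by rwa [hke]), hup, hup,
          hb.add (fun m => E (k.succAbove m)) l A B h h', smul_add]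
      · rw [if_neg hm, if_neg (by rwa [hke]), if_neg (by rwa [hke]), add_zero]
  · unfold cone
    rw [Finset.smul_sum, ← Equiv.sum_comp σ (fun k => (Equiv.Perm.sign σ : ℤ) • coneTerm y b E k)]
    exact Finset.sum_congr rfl fun k _ => coneTerm_perm y hb E σ k
  · have hE : (fun k => E (Equiv.swap i j k)) = E := by
      funext k
      rw [Equiv.swap_apply_def]
      split_ifs with h1 h2
      · rw [h1, h']
      · rw [h2, h']
      · rfl
    -- The swap of `i` and `j` fixes `E` and exchanges the terms at `i` and `j` up to sign, so these
    -- cancel; every other term keeps both equal arguments.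
    have hij := coneTerm_perm y hb E (Equiv.swap i j) i
    rw [hE, Equiv.swap_apply_left, Equiv.Perm.sign_swap h] at hij
    unfold cone
    rw [Finset.sum_eq_add i j h (fun k _ hk => ?_) (by simp) (by simp), hij]
    · simp
    · obtain ⟨i', rfl⟩ := Fin.exists_succAbove_eq hk.1.symm
      obtain ⟨j', rfl⟩ := Fin.exists_succAbove_eq hk.2.symm
      unfold coneTerm
      rw [hb.alt _ i' j' (fun e => h (by rw [e])) h', smul_zero, ite_self]
  · have : ∃ i, y ∉ closure (E i).1 := by
      by_contra! hc
      exact (Set.eq_empty_iff_forall_notMem.1 h) y (Set.mem_iInter.2 hc)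
    obtain ⟨i, hi⟩ := this
    refine Finset.sum_eq_zero fun k _ => ?_
    unfold coneTerm
    by_cases hk : i = k
    · subst hk
      exact if_neg fun hm => hi (subset_closure hm)
    · obtain ⟨l, rfl⟩ := Fin.exists_succAbove_eq hk
      rw [hy _ l hi, smul_zero, ite_self]

variable [CompactSpace Y]

/-- The whole of a compact space as a bounded set. -/
def Bdd.univ (Y : Type u) [TopologicalSpace Y] [CompactSpace Y] : Bdd Y :=
  ⟨Set.univ, isClosed_closure.isCompact⟩

theorem bdryFun_eq_univ [T2Space Y] {n : ℕ} {b : (Fin (n + 1 + 1) → Bdd Y) → H}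
    (hb : IsChain b) (E : Fin (n + 1) → Bdd Y) :
    bdryFun b E = b (Fin.cons (Bdd.univ Y) E) :=
  bdryFun_eq hb E _ ⟨isOpen_univ, Set.subset_univ _⟩

/-- The cone identity. Omitting the leading whole space returns `b E`, since it contains `y`;
omitting any later argument shifts its index by one and flips the sign. -/
theorem cone_cons_univ (y : Y) {n : ℕ} (b : (Fin (n + 1) → Bdd Y) → H)
    (E : Fin (n + 1) → Bdd Y) :
    cone y b (Fin.cons (Bdd.univ Y) E) =
      b E - cone y (fun F => b (Fin.cons (Bdd.univ Y) F)) E := by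
  unfold cone
  rw [Fin.sum_univ_succ, sub_eq_add_neg, ← Finset.sum_neg_distrib]
  congr 1
  · simp [coneTerm, Bdd.univ]
  · refine Finset.sum_congr rfl fun k _ => ?_
    have : (fun i => (Fin.cons (Bdd.univ Y) E : Fin (n + 1 + 1) → Bdd Y) (k.succ.succAbove i)) =
        Fin.cons (Bdd.univ Y) (fun i => E (k.succAbove i)) := by
      funext i
      refine Fin.cases ?_ (fun l => ?_) i
      · simp
      · simp
    unfold coneTerm
    rw [this, Fin.cons_succ]
    split_ifs
    · simp [pow_succ]
    · simp

end Cone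

/-! ### Acyclicity at infinity -/

section Infinity

variable {X : Type u} [TopologicalSpace X] [LocallyCompactSpace X] [T2Space X]
  {G : Type v} [AddCommGroup G]

/-- The cone with vertex at infinity of a chain that vanishes on `X`. -/
noncomputable def inftyCone {n : ℕ} (F : chains (OnePoint X) G n)
    (hF : restrict G ((↑) : X → OnePoint X) OnePoint.isOpenEmbedding_coe n F = 0) :
    chains (OnePoint X) G (n + 1) :=
  ⟨cone OnePoint.infty F.1, isChain_cone F.2 (eq_zero_of_restrict_eq_zero F hF)⟩

theorem restrict_inftyCone {n : ℕ} (F : chains (OnePoint X) G n)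
    (hF : restrict G ((↑) : X → OnePoint X) OnePoint.isOpenEmbedding_coe n F = 0) :
    restrict G ((↑) : X → OnePoint X) OnePoint.isOpenEmbedding_coe (n + 1) (inftyCone F hF) = 0 := by
  refine Subtype.ext (funext fun E => ?_)
  change cone OnePoint.infty F.1 _ = 0
  exact Finset.sum_eq_zero fun _ _ => if_neg OnePoint.infty_notMem_image_coe

theorem bdry_inftyCone_apply {n : ℕ} (F : chains (OnePoint X) G n)
    (hF : restrict G ((↑) : X → OnePoint X) OnePoint.isOpenEmbedding_coe n F = 0)
    (E : Fin (n + 1) → Bdd (OnePoint X)) :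
    (bdry (OnePoint X) G n (inftyCone F hF)).1 E =
      F.1 E - cone OnePoint.infty (fun D => F.1 (Fin.cons (Bdd.univ (OnePoint X)) D)) E :=
  (bdryFun_eq_univ (inftyCone F hF).2 E).trans (cone_cons_univ _ _ _)

theorem bdry_inftyCone {n : ℕ} (F : chains (OnePoint X) G (n + 1))
    (hF : restrict G ((↑) : X → OnePoint X) OnePoint.isOpenEmbedding_coe (n + 1) F = 0)
    (hd : bdry (OnePoint X) G n F = 0) :
    bdry (OnePoint X) G (n + 1) (inftyCone F hF) = F := by
  refine Subtype.ext (funext fun E => ?_)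
  rw [bdry_inftyCone_apply, sub_eq_self]
  refine Finset.sum_eq_zero fun k _ => ?_
  unfold coneTerm
  beta_reduce
  rw [← bdryFun_eq_univ F.2]
  have : bdryFun F.1 (fun i => E (k.succAbove i)) = 0 := congrFun (congrArg Subtype.val hd) _
  rw [this, smul_zero, ite_self]

open Classical in
/-- The zero-chain at infinity with mass `g`. -/
noncomputable def inftyMass (X : Type u) [TopologicalSpace X] (g : G) :
    chains ({OnePoint.infty} : Set (OnePoint X)) G 0 :=
  ⟨fun E => if ⟨OnePoint.infty, rfl⟩ ∈ (E 0).1 then g else 0, by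
    refine ⟨fun E i A B h h' => ?_, fun E σ => ?_, fun E i j h h' => ?_, fun E h => ?_⟩
    · obtain rfl : i = 0 := Subsingleton.elim (α := Fin 1) _ _
      simp only [h, Function.update_self, Set.mem_union]
      have hAB : ¬ ((⟨OnePoint.infty, rfl⟩ : ({OnePoint.infty} : Set (OnePoint X))) ∈ A.1 ∧
          ⟨OnePoint.infty, rfl⟩ ∈ B.1) := fun hh => by
        have : _ ∈ A.1 ∩ B.1 := hh
        rw [h'] at this
        exact this
      split_ifs <;> simp_all
    · obtain rfl : σ = 1 := Subsingleton.elim (α := Equiv.Perm (Fin 1)) _ _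
      rw [Equiv.Perm.sign_one]
      exact (one_smul ℤ _).symm
    · exact absurd (Subsingleton.elim (α := Fin 1) i j) h
    · refine if_neg fun hm => (Set.eq_empty_iff_forall_notMem.1 h) ⟨OnePoint.infty, rfl⟩
        (Set.mem_iInter.2 fun i => ?_)
      obtain rfl : i = 0 := Subsingleton.elim (α := Fin 1) _ _
      exact subset_closure hm⟩

/-- In degree zero the correction in the cone identity is the total mass of `F` placed at infinity,
which comes from a chain of the point. -/
theorem bdry_inftyCone_add_push (F : chains (OnePoint X) G 0)
    (hF : restrict G ((↑) : X → OnePoint X) OnePoint.isOpenEmbedding_coe 0 F = 0) :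
    bdry (OnePoint X) G 0 (inftyCone F hF) +
      push G _ (isProperMap_val isClosed_singleton) 0
        (inftyMass X (F.1 fun _ => Bdd.univ (OnePoint X))) = F := by
  refine Subtype.ext (funext fun E => ?_)
  change (bdry (OnePoint X) G 0 (inftyCone F hF)).1 E + _ = _
  rw [bdry_inftyCone_apply, sub_add, sub_eq_self, sub_eq_zero]
  unfold cone
  rw [Fin.sum_univ_one]
  unfold coneTerm
  simp only [Fin.val_zero, pow_zero, one_smul]
  have : ∀ D : Fin 0 → Bdd (OnePoint X),
      (Fin.cons (Bdd.univ (OnePoint X)) D : Fin 1 → Bdd (OnePoint X)) =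
        fun _ => Bdd.univ (OnePoint X) := by
    intro D
    funext i
    obtain rfl : i = 0 := Subsingleton.elim (α := Fin 1) _ _
    rfl
  rw [this]
  rfl

/-- A boundary that comes from the point at infinity vanishes. -/
theorem bdry_eq_zero_of_eq_push {n : ℕ} (F : chains (OnePoint X) G (n + 1))
    (g : chains ({OnePoint.infty} : Set (OnePoint X)) G n)
    (h : push G _ (isProperMap_val isClosed_singleton) n g = bdry (OnePoint X) G n F) :
    bdry (OnePoint X) G n F = 0 := by
  have h0 : (bdry (OnePoint X) G n F).1 (fun _ => Bdd.univ (OnePoint X)) = 0 :=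
    (bdryFun_eq_univ F.2 _).trans (F.2.alt _ 0 (Fin.succ 0) (Fin.succ_ne_zero 0).symm rfl)
  refine Subtype.ext (funext fun E => ?_)
  -- A chain pushed from the point takes one common value on all tuples whose members contain
  -- infinity, the whole-space tuple among them, and is zero on the rest. Alternation makes that
  -- value zero here.
  by_cases hE : ∀ i, OnePoint.infty ∈ (E i).1
  · refine Eq.trans ?_ h0
    rw [← h]
    refine congrArg g.1 (funext fun i => Subtype.ext (Set.ext fun a => ?_))
    obtain ⟨a, rfl⟩ := a
    exact ⟨fun _ => trivial, fun _ => hE i⟩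
  · push Not at hE
    obtain ⟨i, hi⟩ := hE
    rw [← h]
    refine IsAdditive.eq_zero_of_eq_empty (i := i) g.2.add ?_
    rw [Set.eq_empty_iff_forall_notMem]
    rintro ⟨a, rfl⟩ ha
    exact hi ha

end Infinity

/-! ### Surjective chain maps with acyclic kernel -/

section HomologicalAlgebra

universe w

theorem isIso_homologyMap_of_shortExact {C ι : Type*} [Category* C] [Abelian C]
    {c : ComplexShape ι} {S : ShortComplex (HomologicalComplex C c)} (hS : S.ShortExact)
    (h : S.X₁.Acyclic) (i : ι) : IsIso (HomologicalComplex.homologyMap S.g i) := by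
  have hz : ∀ j, IsZero (S.X₁.homology j) := fun j => (h j).isZero_homology
  have : Mono (HomologicalComplex.homologyMap S.g i) :=
    (hS.homology_exact₂ i).mono_g ((hz i).eq_of_src _ _)
  have : Epi (HomologicalComplex.homologyMap S.g i) := by
    -- With no outgoing relation at `i` there is no connecting map; surjectivity on homology then
    -- follows from that of the chain map.
    by_cases! hi : ∃ j, c.Rel i j
    · obtain ⟨j, hij⟩ := hi
      exact (hS.homology_exact₃ i j hij).epi_f ((hz j).eq_of_tgt _ _)
    · have := hS.epi_g
      exact HomologicalComplex.epi_homologyMap_of_epi_of_not_rel S.g i hi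
  exact isIso_of_mono_of_epi _

/-- A surjective chain map whose kernel is exact induces isomorphisms in homology. -/
theorem isIso_homologyMap_of_surjective {ι : Type*} {c : ComplexShape ι}
    {Q K : HomologicalComplex AddCommGrpCat.{w} c} (φ : Q ⟶ K)
    (hs : ∀ i, Function.Surjective (φ.f i))
    (hk : ∀ i j k, c.prev j = i → c.next j = k → ∀ q : Q.X j, φ.f j q = 0 → Q.d j k q = 0 →
      ∃ w : Q.X i, φ.f i w = 0 ∧ Q.d i j w = q) (n : ι) :
    IsIso (HomologicalComplex.homologyMap φ n) := by
  have : ∀ i, Epi (φ.f i) := fun i => (AddCommGrpCat.epi_iff_surjective _).2 (hs i)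
  have : Epi φ := HomologicalComplex.epi_of_epi_f φ inferInstance
  let S : ShortComplex (HomologicalComplex AddCommGrpCat.{w} c) :=
    ShortComplex.mk (kernel.ι φ) φ (kernel.condition φ)
  have hS : S.ShortExact :=
    { exact := ShortComplex.exact_of_f_is_kernel _ (kernelIsKernel φ)
      mono_f := inferInstanceAs (Mono (kernel.ι φ))
      epi_g := this }
  refine isIso_homologyMap_of_shortExact hS (fun j => ?_) n
  have hdeg := (HomologicalComplex.shortExact_iff_degreewise_shortExact S).1 hS
  have hinj : ∀ i, Function.Injective ((kernel.ι φ).f i) := fun i => (hdeg i).ab_injective_f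
  have hex : ∀ i (q : Q.X i), φ.f i q = 0 → ∃ w, (kernel.ι φ).f i w = q := fun i =>
    (ShortComplex.ab_exact_iff _).1 (hdeg i).exact
  rw [HomologicalComplex.exactAt_iff, ShortComplex.ab_exact_iff]
  intro z hz
  have hcomm : ∀ i k (x : (kernel φ).X i), (kernel.ι φ).f k ((kernel φ).d i k x) =
      Q.d i k ((kernel.ι φ).f i x) := fun i k x =>
    (ConcreteCategory.congr_hom ((kernel.ι φ).comm i k) x).symm
  obtain ⟨w, hw, hdw⟩ := hk _ j _ rfl rfl ((kernel.ι φ).f j z)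
    (ConcreteCategory.congr_hom (HomologicalComplex.congr_hom (kernel.condition φ) j) z)
    ((hcomm _ _ z).symm.trans ((congrArg _ hz).trans (map_zero _)))
  obtain ⟨x, rfl⟩ := hex _ w hw
  exact ⟨x, hinj j ((hcomm _ _ x).trans hdw)⟩

theorem cokernel_π_f_surjective {ι : Type*} {c : ComplexShape ι}
    {K L : HomologicalComplex AddCommGrpCat.{w} c} (p : K ⟶ L) (i : ι) :
    Function.Surjective ((cokernel.π p).f i) :=
  (AddCommGrpCat.epi_iff_surjective _).1 inferInstance

theorem exists_of_cokernel_π_f_eq_zero {ι : Type*} {c : ComplexShape ι}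
    {K L : HomologicalComplex AddCommGrpCat.{w} c} (p : K ⟶ L) (i : ι) (x : L.X i)
    (hx : (cokernel.π p).f i x = 0) : ∃ y : K.X i, p.f i y = x :=
  (ShortComplex.ab_exact_iff _).1 ((HomologicalComplex.exact_iff_degreewise_exact
    (ShortComplex.mk p (cokernel.π p) (cokernel.condition p))).1
      (ShortComplex.exact_of_g_is_cokernel _ (cokernelIsCokernel p)) i) x hx

end HomologicalAlgebra

/-! ### The restriction isomorphism -/

section Main

variable {X : Type u} [TopologicalSpace X] [LocallyCompactSpace X] [T2Space X]
  (G : Type v) [AddCommGroup G]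

theorem complex_d_apply {n : ℕ} (F : chains X G (n + 1)) :
    (complex X G).d (n + 1) n F = bdry X G n F := by
  simp only [complex, ChainComplex.of_d]
  rfl

theorem isIso_relRestrict_infty (n : ℕ) :
    IsIso (relRestrict G ({OnePoint.infty} : Set (OnePoint X)) isClosed_singleton
      ((↑) : X → OnePoint X) OnePoint.isOpenEmbedding_coe OnePoint.coe_ne_infty n) := by
  have hA : IsClosed ({OnePoint.infty} : Set (OnePoint X)) := isClosed_singleton
  have : LocallyCompactSpace ({OnePoint.infty} : Set (OnePoint X)) :=
    hA.isClosedEmbedding_subtypeVal.locallyCompactSpace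
  let p := pushMap G ((↑) : ({OnePoint.infty} : Set (OnePoint X)) → OnePoint X)
    (isProperMap_val hA)
  let φ := relRestrictMap G ({OnePoint.infty} : Set (OnePoint X)) hA
      ((↑) : X → OnePoint X) OnePoint.isOpenEmbedding_coe OnePoint.coe_ne_infty
  have hφ : ∀ (i : ℕ) (F : chains (OnePoint X) G i), φ.f i ((cokernel.π p).f i F) =
      restrict G ((↑) : X → OnePoint X) OnePoint.isOpenEmbedding_coe i F := fun i F =>
    ConcreteCategory.congr_hom (HomologicalComplex.congr_hom (cokernel.π_desc p _ _) i) F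
  have hd : ∀ (i : ℕ) (F : chains (OnePoint X) G (i + 1)),
      (cokernel p).d (i + 1) i ((cokernel.π p).f (i + 1) F) =
        (cokernel.π p).f i (bdry (OnePoint X) G i F) := fun i F =>
    (ConcreteCategory.congr_hom ((cokernel.π p).comm (i + 1) i) F).trans
      (congrArg ((cokernel.π p).f i) (complex_d_apply G F))
  have hp : ∀ (i : ℕ) (F : chains (OnePoint X) G i), (cokernel.π p).f i F = 0 →
      ∃ g : chains ({OnePoint.infty} : Set (OnePoint X)) G i,
        push G _ (isProperMap_val hA) i g = F := fun i F h =>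
    exists_of_cokernel_π_f_eq_zero p i F h
  have hp' : ∀ (i : ℕ) (g : chains ({OnePoint.infty} : Set (OnePoint X)) G i),
      (cokernel.π p).f i (push G _ (isProperMap_val hA) i g) = 0 := fun i g =>
    ConcreteCategory.congr_hom (HomologicalComplex.congr_hom (cokernel.condition p) i) g
  refine isIso_homologyMap_of_surjective φ (fun i f => ?_) (fun i j k hi hk q hq hdq => ?_) n
  · obtain ⟨F, hF⟩ := restrict_surjective (X := X) (G := G) i f
    exact ⟨(cokernel.π p).f i F, (hφ i F).trans hF⟩
  · obtain rfl : j + 1 = i := (ChainComplex.prev ℕ j).symm.trans hi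
    obtain ⟨F, rfl⟩ := cokernel_π_f_surjective p j q
    have hF : restrict G ((↑) : X → OnePoint X) OnePoint.isOpenEmbedding_coe j F = 0 :=
      (hφ j F).symm.trans hq
    refine ⟨(cokernel.π p).f (j + 1) (inftyCone F hF),
      (hφ _ _).trans (restrict_inftyCone F hF), (hd _ _).trans ?_⟩
    -- In degree zero the cone bounds `F` only up to a mass at infinity, which is zero in the
    -- quotient. In higher degrees a relative cycle concentrated at infinity is an absolute cycle,
    -- and its cone bounds it.
    cases j with
    | zero =>
      conv_rhs => rw [← bdry_inftyCone_add_push F hF]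
      exact ((map_add _ _ _).trans ((congrArg _ (hp' 0 _)).trans (add_zero _))).symm
    | succ j =>
      obtain rfl : j = k := (ChainComplex.next_nat_succ j).symm.trans hk
      obtain ⟨g, hg⟩ := hp j _ ((hd j F).symm.trans hdq)
      rw [bdry_inftyCone F hF (bdry_eq_zero_of_eq_push F g hg)]

end Main

end Kolmogoroff

theorem corollary2 {X : Type u} [TopologicalSpace X] [LocallyCompactSpace X] [ParacompactSpace X]
    [T2Space X] (G : Type v) [AddCommGroup G] (n : ℕ) :
    ∃ ρ : Kolmogoroff.homology X G n ≅
        Kolmogoroff.relHomology G ({OnePoint.infty} : Set (OnePoint X)) isClosed_singleton n,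
      ρ.inv = Kolmogoroff.relRestrict G ({OnePoint.infty} : Set (OnePoint X)) isClosed_singleton
        ((↑) : X → OnePoint X) OnePoint.isOpenEmbedding_coe OnePoint.coe_ne_infty n := by
  have := Kolmogoroff.isIso_relRestrict_infty (X := X) G n
  exact ⟨(asIso (Kolmogoroff.relRestrict G ({OnePoint.infty} : Set (OnePoint X))
    isClosed_singleton ((↑) : X → OnePoint X) OnePoint.isOpenEmbedding_coe
    OnePoint.coe_ne_infty n)).symm, rfl⟩
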